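/- Let $\Gamma$ be a countable group acting without inversion by graph automorphisms on a tree $\mathcal T$ with at least two vertices. Here "without inversion" means that no element of $\Gamma$ exchanges the two endpoints of an edge, and the stabilizer of an edge is the subgroup of the elements fixing both of its endpoints. A subgroup $\Sigma$ of a group $H$ is called highly core-free in $H$ if for every finite subset $F\subset H$ there exists $g\in H$ such that $gF\cap\Sigma F=\emptyset$ and $\Sigma gu\cap\Sigma gv=\emptyset$ for all $u,v\in F$ with $u\neq v$. Suppose that the stabilizer of every vertex of $\mathcal T$ is infinite and that, for every edge $e$ of $\mathcal T$, the stabilizer of $e$ is finite and is highly core-free in the stabilizer of each of the two endpoints of $e$. Let $\mathcal R$ be the Random Graph, i.e. the unique (up to isomorphism) countable simple graph such that for any two disjoint finite sets $U,W$ of vertices there is a vertex outside $U\cup W$ that is adjacent to every vertex of $U$ and to no vertex of $W$. Then there is an injective group homomorphism $\pi:\Gamma\to\mathrm{Aut}(\mathcal R)$ such that for every graph isomorphism $\varphi:A\to B$ between finite induced subgraphs $A,B$ of $\mathcal R$ there exists $g\in\Gamma$ with $\pi(g)u=\varphi(u)$ for every vertex $u$ of $A$; that is, $\Gamma$ admits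 a faithful homogeneous action on $\mathcal R$. -/

import Mathlib

/-- `R` is a random graph: it has countably many vertices, and for any disjoint finite sets `U`, `W`
of vertices there is a vertex outside `U ∪ W` adjacent to all of `U` and to nothing in `W`.
Such a graph is infinite, and it is unique up to isomorphism. -/
structure IsRandomGraph {V : Type*} (R : SimpleGraph V) : Prop where
  countable : Countable V
  exists_adj : ∀ U W : Finset V, Disjoint U W →
    ∃ z, z ∉ U ∧ z ∉ W ∧ (∀ u ∈ U, R.Adj z u) ∧ ∀ w ∈ W, ¬ R.Adj z w

/-- The graph on `ℕ` in which distinct `m`, `n` are adjacent if and only if the `n`-th binary digit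
of `m` or the `m`-th binary digit of `n` is one. -/
def bitGraph : SimpleGraph ℕ where
  Adj m n := m ≠ n ∧ (m.testBit n = true ∨ n.testBit m = true)
  symm := ⟨fun _ _ h => ⟨h.1.symm, h.2.symm⟩⟩
  loopless := ⟨fun _ h => h.1 rfl⟩

/-- Random graphs exist. -/
theorem isRandomGraph_bitGraph : IsRandomGraph bitGraph := by
  refine ⟨inferInstance, fun U W hUW => ?_⟩
  obtain ⟨m, hm⟩ : ∃ m, ∀ x ∈ U ∪ W, x < m :=
    ⟨(U ∪ W).sup id + 1, fun x hx => Nat.lt_succ_of_le (Finset.le_sup (f := id) hx)⟩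
  let z := Nat.ofBits (n := m + 1) fun i => decide ((i : ℕ) ∈ U ∨ (i : ℕ) = m)
  have hz : ∀ i, i < m + 1 → z.testBit i = decide (i ∈ U ∨ i = m) := fun i hi =>
    Nat.testBit_ofBits_lt _ i hi
  have hmz : m < z := by
    by_contra h
    have h1 := hz m (Nat.lt_succ_self m)
    rw [Nat.testBit_lt_two_pow (lt_of_le_of_lt (not_lt.1 h) Nat.lt_two_pow_self)] at h1
    simp at h1
  have hlt : ∀ x ∈ U ∪ W, x < z := fun x hx => (hm x hx).trans hmz
  refine ⟨z, fun h => (hlt z (Finset.mem_union_left _ h)).false,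
    fun h => (hlt z (Finset.mem_union_right _ h)).false, fun u hu => ?_, fun w hw => ?_⟩
  · have hu' := Finset.mem_union_left W hu
    exact ⟨(hlt u hu').ne', Or.inl (by rw [hz u ((hm u hu').trans (Nat.lt_succ_self m))]; simp [hu])⟩
  · have hw' := Finset.mem_union_right U hw
    rintro ⟨-, h | h⟩
    · rw [hz w ((hm w hw').trans (Nat.lt_succ_self m))] at h
      rcases of_decide_eq_true h with h | h
      · exact Finset.disjoint_left.1 hUW h hw
      · exact (hm w hw').ne h
    · rw [Nat.testBit_lt_two_pow ((hlt w hw').trans Nat.lt_two_pow_self)] at h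
      simp at h

/-- An action of a group on a graph is homogeneous if every isomorphism between finite induced
subgraphs is the restriction of some group element. -/
def IsHomogeneousAction {Γ V : Type*} [Group Γ] {R : SimpleGraph V} (π : Γ →* (R ≃g R)) : Prop :=
  ∀ A B : Set V, A.Finite → B.Finite → ∀ φ : R.induce A ≃g R.induce B,
    ∃ g : Γ, ∀ u : A, π g (u : V) = (φ u : V)

/-- A subgroup `S` of `H` is highly core-free if for every finite `F ⊆ H` there is `g ∈ H` such that
`g F ∩ S F = ∅` and the sets `S g u`, for `u ∈ F`, are pairwise disjoint. -/
def Subgroup.IsHighlyCoreFree {H : Type*} [Group H] (S : Subgroup H) : Prop :=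
  ∀ F : Finset H, ∃ g : H,
    (∀ u ∈ F, ∀ v ∈ F, ∀ s ∈ S, g * u ≠ s * v) ∧
    (∀ u ∈ F, ∀ v ∈ F, u ≠ v → ∀ s ∈ S, ∀ t ∈ S, s * (g * u) ≠ t * (g * v))

/-- The stabilizer of the oriented edge from `x` to `y`: the elements fixing both endpoints. -/
def edgeStabilizer (Γ : Type*) {X : Type*} [Group Γ] [MulAction Γ X] (x y : X) : Subgroup Γ :=
  MulAction.stabilizer Γ x ⊓ MulAction.stabilizer Γ y

/-!
The random graph is found as a graph on `Γ ⧸ Λ`, where `a Λ` and `b Λ` are adjacent if and only if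
`a⁻¹ b` lies in a symmetric union `P` of double cosets of `Λ`, and `Γ` acts by left translation.
The pair `Λ`, `P` is the limit of approximations: a subgroup acting freely on the tree, with an
invariant subtree (its core) that is finite modulo the subgroup, together with finitely many double
cosets declared to be edges or non-edges.

Every requirement on the limit (the extension property of the random graph, faithfulness, the
realization of a given partial isomorphism) can be met by enlarging an approximation. The
essential case is the last one: `g` moves `a Λ` to `b Λ` if and only if `b⁻¹ g a ∈ Λ`, so finitely
many such elements have to be adjoined to the subgroup. High core-freeness of an edge stabilizer
provides edges that leave the core and all its translates by decided elements, and `g` can be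
chosen such that the adjoined elements fold such edges head to head. By ping-pong on the half-trees
beyond these edges, the enlarged subgroup still acts freely, the translates of the old core joined
along the folded edges form its core, and no two cosets decided to be different become equal. As
`Γ` is countable, there are countably many requirements, and a limit meeting all of them exists. A
back-and-forth argument identifies its graph with the given one.
-/

open Pointwise SimpleGraph

/-! ### Half-trees -/

section HalfTree

variable {X : Type*} {G T : SimpleGraph X} {K K' : Set X} {p q p' q' x y : X}

theorem connected_induce_of_reachable (hGT : G ≤ T) (hp : p ∈ K)
    (hK : ∀ a ∈ K, ∀ b, G.Adj a b → b ∈ K) (hreach : ∀ x ∈ K, G.Reachable p x) :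
    (T.induce K).Connected := by
  have key : ∀ x, G.Reachable p x → ∃ hx : x ∈ K, (T.induce K).Reachable ⟨p, hp⟩ ⟨x, hx⟩ := by
    intro x h
    rw [reachable_iff_reflTransGen] at h
    induction h with
    | refl => exact ⟨hp, .rfl⟩
    | tail _ hab ih =>
      obtain ⟨ha, h⟩ := ih
      have hab' : (T.induce K).Adj ⟨_, ha⟩ ⟨_, hK _ ha _ hab⟩ := hGT hab
      exact ⟨_, h.trans hab'.reachable⟩
  exact (connected_iff_exists_forall_reachable _).2
    ⟨⟨p, hp⟩, fun ⟨x, hx⟩ => (key x (hreach x hx)).2⟩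

theorem reachable_of_connected_induce (hK : (T.induce K).Connected)
    (hKG : ∀ a ∈ K, ∀ b ∈ K, T.Adj a b → G.Adj a b) (hx : x ∈ K) (hy : y ∈ K) :
    G.Reachable x y :=
  (hK ⟨x, hx⟩ ⟨y, hy⟩).map ⟨Subtype.val, fun {a b} hab => hKG a a.2 b b.2 hab⟩

theorem connected_induce_singleton (T : SimpleGraph X) (x : X) :
    (T.induce {x}).Connected :=
  connected_induce_of_reachable (G := ⊥) bot_le rfl (fun _ _ _ h => h.elim)
    fun _ h => h ▸ Reachable.rfl

/-- The vertices on the side of `q` after the edge between `p` and `q` is removed from `T`. -/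
def halfTree (T : SimpleGraph X) (p q : X) : Set X :=
  {x | (T.deleteEdges {s(p, q)}).Reachable q x}

theorem right_mem_halfTree (T : SimpleGraph X) (p q : X) : q ∈ halfTree T p q := Reachable.rfl

theorem mem_halfTree_of_adj (hx : x ∈ halfTree T p q) (hxy : T.Adj x y) (hy : y ≠ p) :
    y ∈ halfTree T p q := by
  by_cases h : s(x, y) = s(p, q)
  · rcases Sym2.eq_iff.1 h with ⟨-, rfl⟩ | ⟨-, rfl⟩
    · exact right_mem_halfTree _ _ _
    · exact absurd rfl hy
  · exact Reachable.trans hx (Adj.reachable (by simpa [hxy] using h))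

theorem connected_induce_halfTree (T : SimpleGraph X) (p q : X) :
    (T.induce (halfTree T p q)).Connected :=
  connected_induce_of_reachable (deleteEdges_le _) (right_mem_halfTree T p q)
    (fun _ ha _ hab => Reachable.trans ha hab.reachable) fun _ hx => hx

theorem adj_of_reachable_of_le (hT : T.IsTree) (hG : G ≤ T) (hpq : T.Adj p q)
    (h : G.Reachable p q) : G.Adj p q := by
  by_contra hn
  refine isBridge_iff.1 (isAcyclic_iff_forall_adj_isBridge.1 hT.isAcyclic hpq) (h.mono ?_)
  intro a b hab
  rw [deleteEdges_adj]
  refine ⟨hG hab, fun he => hn ?_⟩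
  rcases Sym2.eq_iff.1 he with ⟨rfl, rfl⟩ | ⟨rfl, rfl⟩
  exacts [hab, hab.symm]

theorem notMem_halfTree_of_connected (hT : T.IsTree) (hK : (T.induce K).Connected)
    (hpq : T.Adj p q) (hp : p ∈ K) (hq : q ∉ K) (hx : x ∈ K) : x ∉ halfTree T p q := by
  intro h
  have hpx : (T.deleteEdges {s(p, q)}).Reachable p x := by
    refine reachable_of_connected_induce hK (fun a ha b hb hab => ?_) hp hx
    refine deleteEdges_adj.2 ⟨hab, fun he => hq ?_⟩
    rcases Sym2.eq_iff.1 he with ⟨-, rfl⟩ | ⟨rfl, -⟩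
    exacts [hb, ha]
  exact isBridge_iff.1 (isAcyclic_iff_forall_adj_isBridge.1 hT.isAcyclic hpq) (hpx.trans h.symm)

theorem mem_halfTree_or_mem_halfTree (hT : T.IsTree) (p q x : X) :
    x ∈ halfTree T p q ∨ x ∈ halfTree T q p := by
  have h := (reachable_iff_reflTransGen _ _).1 (hT.connected.preconnected p x)
  induction h with
  | refl => exact Or.inr (right_mem_halfTree _ _ _)
  | @tail a b _ hab ih =>
    rcases ih with ha | ha
    · by_cases hb : b = p
      · exact Or.inr (hb ▸ right_mem_halfTree _ _ _)
      · exact Or.inl (mem_halfTree_of_adj ha hab hb)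
    · by_cases hb : b = q
      · exact Or.inl (hb ▸ right_mem_halfTree _ _ _)
      · exact Or.inr (mem_halfTree_of_adj ha hab hb)

theorem subset_halfTree_of_connected (hT : T.IsTree) (hK : (T.induce K).Connected)
    (hpq : T.Adj p q) (hp : p ∉ K) (hq : q ∈ K) : K ⊆ halfTree T p q := fun x hx =>
  (mem_halfTree_or_mem_halfTree hT p q x).resolve_right
    (notMem_halfTree_of_connected hT hK hpq.symm hq hp hx)

theorem eq_of_mem_halfTree_of_mem_halfTree (hT : T.IsTree) (hK : (T.induce K).Connected)
    (hp : p ∈ K) (hp' : p' ∉ K) (hq : q ∈ K) (hq' : q' ∉ K) (hpp : T.Adj p p') (hqq : T.Adj q q')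
    (hx : x ∈ halfTree T p p') (hx' : x ∈ halfTree T q q') : p = q ∧ p' = q' := by
  by_contra hne
  have hp'_notMem : p' ∉ halfTree T q q' := by
    intro h
    by_cases hpq : p = q
    · subst hpq
      have hp'q' : p' ≠ q' := fun h => hne ⟨rfl, h⟩
      have hpair := connected_induce_union (connected_induce_singleton T p).preconnected
        (connected_induce_singleton T p').preconnected rfl rfl hpp
      refine notMem_halfTree_of_connected hT hpair hqq (Or.inl rfl) ?_ (Or.inr rfl) h
      rintro (rfl | rfl)
      exacts [hq' hp, hp'q' rfl]
    · exact notMem_halfTree_of_connected hT hK hqq hq hq' hp (mem_halfTree_of_adj h hpp.symm hpq)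
  have hunion : (T.induce (K ∪ halfTree T q q')).Connected :=
    connected_induce_union hK.preconnected (connected_induce_halfTree T q q').preconnected hq
      (right_mem_halfTree _ _ _) hqq
  refine notMem_halfTree_of_connected hT hunion hpp (Or.inl hp) ?_ (Or.inr hx') hx
  rintro (h | h)
  exacts [hp' h, hp'_notMem h]

theorem halfTree_subset_halfTree (hT : T.IsTree) (hpq : T.Adj p q) (hqx : T.Adj q x)
    (hpx : p ≠ x) : halfTree T q x ⊆ halfTree T p q := fun z hz =>
  (mem_halfTree_or_mem_halfTree hT p q z).resolve_right fun h =>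
    hpx (eq_of_mem_halfTree_of_mem_halfTree hT (connected_induce_singleton T q) rfl hpq.ne rfl
      hqx.ne' hpq.symm hqx h hz).2

theorem mem_or_exists_mem_halfTree (hT : T.IsTree) (hp : p ∈ K) (x : X) :
    x ∈ K ∨ ∃ c ∈ K, ∃ c' ∉ K, T.Adj c c' ∧ x ∈ halfTree T c c' := by
  have h := (reachable_iff_reflTransGen _ _).1 (hT.connected.preconnected p x)
  induction h with
  | refl => exact Or.inl hp
  | @tail a b _ hab ih =>
    by_cases hb : b ∈ K
    · exact Or.inl hb
    rcases ih with ha | ⟨c, hc, c', hc', hcc, ha⟩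
    · exact Or.inr ⟨a, ha, b, hb, hab, right_mem_halfTree _ _ _⟩
    · exact Or.inr ⟨c, hc, c', hc', hcc, mem_halfTree_of_adj ha hab fun h => hb (h ▸ hc)⟩

theorem exists_adj_mem_inter (hT : T.IsTree) (hK : (T.induce K).Connected)
    (hK' : (T.induce K').Connected) (hp : p ∈ K ∩ K') (hx : x ∈ K ∩ K') (hne : x ≠ p) :
    ∃ q ∈ K ∩ K', T.Adj p q := by
  rcases mem_or_exists_mem_halfTree (K := {p}) hT rfl x with h | ⟨c, rfl, q, -, hcq, hq⟩
  · exact absurd h hne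
  refine ⟨q, ⟨?_, ?_⟩, hcq⟩ <;> by_contra h
  · exact notMem_halfTree_of_connected hT hK hcq hp.1 h hx.1 hq
  · exact notMem_halfTree_of_connected hT hK' hcq hp.2 h hx.2 hq

theorem eq_of_adj_of_adj_of_notMem (hT : T.IsTree) (hK : (T.induce K).Connected) (hp : p ∈ K)
    (hq : q ∈ K) (hx : x ∉ K) (hpx : T.Adj p x) (hqx : T.Adj q x) : p = q :=
  (eq_of_mem_halfTree_of_mem_halfTree hT hK hp hx hq hx hpx hqx (right_mem_halfTree _ _ _)
    (right_mem_halfTree _ _ _)).1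

end HalfTree

/-! ### Groups acting on trees -/

/-- An action of `Γ` on the tree `T` by graph automorphisms. -/
structure IsTreeAction (Γ : Type*) {X : Type*} [Group Γ] [MulAction Γ X] (T : SimpleGraph X) :
    Prop where
  isTree : T.IsTree
  adj_smul : ∀ (g : Γ) (x y : X), T.Adj x y → T.Adj (g • x) (g • y)

/-- The edges of `T` that lie in a single translate of `K` by an element of `M`. -/
def tileGraph {Γ X : Type*} [Group Γ] [MulAction Γ X] (T : SimpleGraph X) (M : Subgroup Γ)
    (K : Set X) : SimpleGraph X where
  Adj a b := T.Adj a b ∧ ∃ w ∈ M, a ∈ w • K ∧ b ∈ w • K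
  symm := ⟨fun _ _ ⟨hab, w, hw, ha, hb⟩ => ⟨hab.symm, w, hw, hb, ha⟩⟩
  loopless := ⟨fun _ h => h.1.ne rfl⟩

namespace IsTreeAction

variable {Γ X : Type*} [Group Γ] [MulAction Γ X] {T : SimpleGraph X} {K : Set X} {S : Set Γ}
  {p q x y : X}

theorem smul_mem_halfTree (hA : IsTreeAction Γ T) (g : Γ) (hx : x ∈ halfTree T p q) :
    g • x ∈ halfTree T (g • p) (g • q) := by
  refine Reachable.map (G' := T.deleteEdges {s(g • p, g • q)}) ⟨fun z => g • z, ?_⟩ hx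
  intro a b hab
  rw [deleteEdges_adj] at hab ⊢
  refine ⟨hA.adj_smul g _ _ hab.1, fun h => hab.2 ?_⟩
  simpa [Sym2.eq_iff] using h

theorem connected_induce_smul (hA : IsTreeAction Γ T) (hK : (T.induce K).Connected) (g : Γ) :
    (T.induce (g • K)).Connected := by
  let f : T.induce K →g T.induce (g • K) :=
    ⟨fun x => ⟨g • (x : X), Set.smul_mem_smul_set x.2⟩, fun hab => hA.adj_smul g _ _ hab⟩
  refine hK.map f ?_
  rintro ⟨_, x, hx, rfl⟩
  exact ⟨⟨x, hx⟩, rfl⟩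

/-- The half-tree beyond the edge by which the fixed vertex hangs off `K` meets its translate. -/
theorem exists_mem_smul_eq_self (hA : IsTreeAction Γ T) (hK : (T.induce K).Connected) {g : Γ}
    (hg : ∀ x, g • x ∈ K ↔ x ∈ K) (hx : g • x = x) : ∃ c ∈ K, g • c = c := by
  obtain ⟨p, hp⟩ := hK.nonempty
  rcases mem_or_exists_mem_halfTree hA.isTree hp x with h | ⟨c, hc, c', hc', hcc, h⟩
  · exact ⟨x, h, hx⟩
  · have hgx := hA.smul_mem_halfTree g h
    rw [hx] at hgx
    exact ⟨c, hc, (eq_of_mem_halfTree_of_mem_halfTree hA.isTree hK hc hc' ((hg c).2 hc)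
      (fun h => hc' ((hg c').1 h)) hcc (hA.adj_smul g _ _ hcc) h hgx).1.symm⟩

theorem reachable_tileGraph (hA : IsTreeAction Γ T) (hK : (T.induce K).Connected)
    (hS : ∀ s ∈ S, (K ∩ s • K).Nonempty) (hx : x ∈ K)
    (hy : y ∈ (Subgroup.closure S : Set Γ) • K) :
    (tileGraph T (Subgroup.closure S) K).Reachable x y := by
  set M := Subgroup.closure S
  have htile : ∀ w ∈ M, ∀ a ∈ w • K, ∀ b ∈ w • K, (tileGraph T M K).Reachable a b :=
    fun w hw a ha b hb => reachable_of_connected_induce (hA.connected_induce_smul hK w)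
      (fun _ ha _ hb hab => ⟨hab, w, hw, ha, hb⟩) ha hb
  have htranslate : ∀ w ∈ M, ∀ a b, (tileGraph T M K).Reachable a b →
      (tileGraph T M K).Reachable (w • a) (w • b) := by
    intro w hw a b h
    refine h.map (⟨fun z => w • z, ?_⟩ : tileGraph T M K →g tileGraph T M K)
    rintro a b ⟨hab, v, hv, ha, hb⟩
    refine ⟨hA.adj_smul w _ _ hab, w * v, mul_mem hw hv, ?_⟩
    simpa only [mul_smul, Set.smul_mem_smul_set_iff] using ⟨ha, hb⟩
  have hbase : ∀ w ∈ M, (tileGraph T M K).Reachable x (w • x) := by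
    intro w hw
    induction hw using Subgroup.closure_induction with
    | mem s hs =>
      obtain ⟨z, hz, hz'⟩ := hS s hs
      have hxz := htile 1 M.one_mem x (by rwa [one_smul]) z (by rwa [one_smul])
      exact hxz.trans (htile s (Subgroup.subset_closure hs) z hz' _ (Set.smul_mem_smul_set hx))
    | one => rw [one_smul]
    | mul a b ha _ hxa hxb =>
      rw [mul_smul]
      exact hxa.trans (htranslate a ha _ _ hxb)
    | inv a ha hxa => simpa only [inv_smul_smul] using (htranslate _ (inv_mem ha) _ _ hxa).symm
  obtain ⟨w, hw, y, hy, rfl⟩ := hy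
  exact (hbase w hw).trans
    (htile w hw _ (Set.smul_mem_smul_set hx) _ (Set.smul_mem_smul_set hy))

theorem connected_induce_closure_smul (hA : IsTreeAction Γ T) (hK : (T.induce K).Connected)
    (hS : ∀ s ∈ S, (K ∩ s • K).Nonempty) :
    (T.induce ((Subgroup.closure S : Set Γ) • K)).Connected := by
  obtain ⟨x, hx⟩ := hK.nonempty
  refine connected_induce_of_reachable (G := tileGraph T (Subgroup.closure S) K) (fun _ _ h => h.1)
    (p := x) ⟨1, one_mem _, x, hx, one_smul _ _⟩ ?_ fun y hy => hA.reachable_tileGraph hK hS hx hy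
  rintro a - b ⟨-, w, hw, -, hb⟩
  exact Set.smul_set_subset_smul hw hb

theorem exists_mem_smul_of_adj (hA : IsTreeAction Γ T) (hK : (T.induce K).Connected)
    (hS : ∀ s ∈ S, (K ∩ s • K).Nonempty) (hp : p ∈ (Subgroup.closure S : Set Γ) • K)
    (hq : q ∈ (Subgroup.closure S : Set Γ) • K) (hpq : T.Adj p q) :
    ∃ w ∈ Subgroup.closure S, p ∈ w • K ∧ q ∈ w • K := by
  obtain ⟨x, hx⟩ := hK.nonempty
  exact (adj_of_reachable_of_le (G := tileGraph T (Subgroup.closure S) K) hA.isTree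
    (fun _ _ h => h.1) hpq
    ((hA.reachable_tileGraph hK hS hx hp).symm.trans (hA.reachable_tileGraph hK hS hx hq))).2

end IsTreeAction

theorem finite_smul_eq_smul_eq {Γ X : Type*} [Group Γ] [MulAction Γ X] {a b : X}
    (hab : Finite (edgeStabilizer Γ a b)) (p q : X) : {g : Γ | g • a = p ∧ g • b = q}.Finite := by
  rcases Set.eq_empty_or_nonempty {g : Γ | g • a = p ∧ g • b = q} with h | ⟨g₀, rfl, rfl⟩
  · exact h ▸ Set.finite_empty
  refine ((edgeStabilizer Γ a b : Set Γ).toFinite.image (g₀ * ·)).subset ?_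
  rintro g ⟨ha, hb⟩
  refine ⟨g₀⁻¹ * g, Subgroup.mem_inf.2 ⟨MulAction.mem_stabilizer_iff.2 ?_,
    MulAction.mem_stabilizer_iff.2 ?_⟩, mul_inv_cancel_left _ _⟩
  · rw [mul_smul, ha, inv_smul_smul]
  · rw [mul_smul, hb, inv_smul_smul]

/-! ### Cores of free subgroups -/

/-- No nontrivial element of `Λ` fixes a point of `X`. -/
def ActsFreely {Γ : Type*} [Group Γ] (Λ : Subgroup Γ) (X : Type*) [MulAction Γ X] : Prop :=
  ∀ g ∈ Λ, ∀ x : X, g • x = x → g = 1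

theorem ActsFreely.eq_of_smul_eq {Γ X : Type*} [Group Γ] [MulAction Γ X] {Λ : Subgroup Γ}
    (hf : ActsFreely Λ X) {g h : Γ} (hg : g ∈ Λ) (hh : h ∈ Λ) {x : X} (hgh : g • x = h • x) :
    g = h := by
  have := hf (h⁻¹ * g) (mul_mem (inv_mem hh) hg) x (by rw [mul_smul, hgh, inv_smul_smul])
  exact (inv_mul_eq_one.1 this).symm

/-- The union of the double cosets `Λ s Λ` with `s ∈ S`. -/
def doubleCosets {Γ : Type*} [Group Γ] (Λ : Subgroup Γ) (S : Set Γ) : Set Γ :=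
  {σ | ∃ g ∈ Λ, ∃ s ∈ S, ∃ h ∈ Λ, g * s * h = σ}

/-- A subtree `C` invariant under `Λ`, with finitely many vertices and edges modulo `Λ`: up to
translation they all lie in a finite set of vertices. -/
structure IsCore {Γ X : Type*} [Group Γ] [MulAction Γ X] (T : SimpleGraph X) (Λ : Subgroup Γ)
    (C : Set X) : Prop where
  smul_mem : ∀ g ∈ Λ, ∀ x ∈ C, g • x ∈ C
  connected : (T.induce C).Connected
  exists_finite : ∃ K : Set X, K.Finite ∧ ∀ p ∈ C, ∀ q ∈ C, (p = q ∨ T.Adj p q) →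
    ∃ g ∈ Λ, g • p ∈ K ∧ g • q ∈ K

theorem isCore_bot_singleton {Γ X : Type*} [Group Γ] [MulAction Γ X] (T : SimpleGraph X) (x : X) :
    IsCore T (⊥ : Subgroup Γ) {x} := by
  refine ⟨?_, connected_induce_singleton T x, {x}, Set.finite_singleton x, ?_⟩
  · rintro g hg y rfl
    rw [Subgroup.mem_bot.1 hg, one_smul, Set.mem_singleton_iff]
  · rintro p hp q hq -
    exact ⟨1, one_mem _, by rwa [one_smul], by rwa [one_smul]⟩

namespace IsCore

variable {Γ X : Type*} [Group Γ] [MulAction Γ X] {T : SimpleGraph X} {Λ : Subgroup Γ} {C : Set X}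
  {Δ D : Set Γ} {p q x y : X}

theorem smul_mem_iff (hC : IsCore T Λ C) {g : Γ} (hg : g ∈ Λ) : g • x ∈ C ↔ x ∈ C :=
  ⟨fun h => by simpa only [inv_smul_smul] using hC.smul_mem g⁻¹ (inv_mem hg) _ h,
    hC.smul_mem g hg x⟩

theorem mem_smul_iff_of_mk_eq (hC : IsCore T Λ C) {σ τ : Γ}
    (h : (σ : Γ ⧸ Λ) = τ) : x ∈ σ • C ↔ x ∈ τ • C := by
  rw [Set.mem_smul_set_iff_inv_smul_mem, Set.mem_smul_set_iff_inv_smul_mem,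
    ← hC.smul_mem_iff (x := τ⁻¹ • x) (QuotientGroup.eq.1 h), mul_smul, smul_inv_smul]

theorem connected_induce_union_smul (hC : IsCore T Λ C) (hA : IsTreeAction Γ T) {σ : Γ}
    (h : (C ∩ σ • C).Nonempty) : (T.induce (C ∪ σ • C)).Connected :=
  induce_union_connected hC.connected.preconnected
    (hA.connected_induce_smul hC.connected σ).preconnected h

theorem finite_neighbors (hC : IsCore T Λ C) (hf : ActsFreely Λ X) (hp : p ∈ C) :
    {q ∈ C | T.Adj p q}.Finite := by
  obtain ⟨K, hK, hKC⟩ := hC.exists_finite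
  refine ((hK.prod hK).biUnion
    (t := fun e => {q | ∃ g ∈ Λ, g • p = e.1 ∧ g • q = e.2}) fun e _ =>
      Set.Subsingleton.finite ?_).subset ?_
  · rintro q ⟨g, hg, hgp, hgq⟩ q' ⟨g', hg', hgp', hgq'⟩
    obtain rfl := hf.eq_of_smul_eq hg hg' (hgp.trans hgp'.symm)
    exact smul_left_cancel g (hgq.trans hgq'.symm)
  · rintro q ⟨hq, hpq⟩
    obtain ⟨g, hg, hgp, hgq⟩ := hKC p hp q hq (Or.inr hpq)
    exact Set.mem_biUnion (Set.mk_mem_prod hgp hgq) ⟨g, hg, rfl, rfl⟩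

theorem connected_induce_union_range (hC : IsCore T Λ C) {L : Type*} {o t : L → X}
    (ho : ∀ l, o l ∈ C) (hadj : ∀ l, T.Adj (o l) (t l)) :
    (T.induce (C ∪ Set.range t)).Connected := by
  obtain ⟨c, hc⟩ := hC.connected.nonempty
  refine induce_connected_of_patches c (Or.inl hc) ?_
  rintro _ (hx | ⟨l, rfl⟩)
  · exact ⟨C, Set.subset_union_left, hc, hx, hC.connected _ _⟩
  · exact ⟨C ∪ {t l}, Set.union_subset_union_right _ (Set.singleton_subset_iff.2 ⟨l, rfl⟩),
      Or.inl hc, Or.inr rfl, connected_induce_union hC.connected.preconnected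
        (connected_induce_singleton T _).preconnected (ho l) rfl (hadj l) _ _⟩

theorem exists_finite_union_range (hC : IsCore T Λ C) (hT : T.IsTree) {L : Type*} [Finite L]
    {o t : L → X} (ho : ∀ l, o l ∈ C) (hadj : ∀ l, T.Adj (o l) (t l)) :
    ∃ K : Set X, K.Finite ∧ ∀ p ∈ C ∪ Set.range t, ∀ q ∈ C ∪ Set.range t, (p = q ∨ T.Adj p q) →
      ∃ g ∈ Λ, g • p ∈ K ∧ g • q ∈ K := by
  obtain ⟨K, hK, hKC⟩ := hC.exists_finite
  let K' := K ∪ (Set.range o ∪ Set.range t)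
  have hone : ∀ p ∈ K', ∀ q ∈ K', ∃ g ∈ Λ, g • p ∈ K' ∧ g • q ∈ K' := fun p hp q hq =>
    ⟨1, one_mem _, by rwa [one_smul], by rwa [one_smul]⟩
  have hout : ∀ p ∈ C, ∀ l, t l ∉ C → T.Adj p (t l) → p = o l := fun p hp l hl hpl =>
    eq_of_adj_of_adj_of_notMem hT hC.connected hp (ho l) hl hpl (hadj l)
  refine ⟨K', hK.union ((Set.finite_range o).union (Set.finite_range t)), fun p hp q hq hpq => ?_⟩
  by_cases hpC : p ∈ C <;> by_cases hqC : q ∈ C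
  · obtain ⟨g, hg, hgp, hgq⟩ := hKC p hpC q hqC hpq
    exact ⟨g, hg, Or.inl hgp, Or.inl hgq⟩
  · obtain ⟨l, rfl⟩ := hq.resolve_left hqC
    obtain rfl := hout p hpC l hqC (hpq.resolve_left fun h => hqC (h ▸ hpC))
    exact hone _ (Or.inr (Or.inl ⟨l, rfl⟩)) _ (Or.inr (Or.inr ⟨l, rfl⟩))
  · obtain ⟨l, rfl⟩ := hp.resolve_left hpC
    obtain rfl := hout q hqC l hpC (hpq.resolve_left fun h => hpC (h ▸ hqC)).symm
    exact hone _ (Or.inr (Or.inr ⟨l, rfl⟩)) _ (Or.inr (Or.inl ⟨l, rfl⟩))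
  · exact hone _ (Or.inr (Or.inr (hp.resolve_left hpC))) _ (Or.inr (Or.inr (hq.resolve_left hqC)))

theorem closure_smul_union_range (hC : IsCore T Λ C) (hA : IsTreeAction Γ T) {L : Type*} [Finite L]
    {o t : L → X} (ho : ∀ l, o l ∈ C) (hadj : ∀ l, T.Adj (o l) (t l)) {S : Set Γ}
    (hΛ : Λ ≤ Subgroup.closure S)
    (hS : ∀ s ∈ S, ((C ∪ Set.range t) ∩ s • (C ∪ Set.range t)).Nonempty) :
    IsCore T (Subgroup.closure S) ((Subgroup.closure S : Set Γ) • (C ∪ Set.range t)) := by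
  have hconn := hC.connected_induce_union_range ho hadj
  obtain ⟨K, hK, hKC⟩ := hC.exists_finite_union_range hA.isTree ho hadj
  refine ⟨?_, hA.connected_induce_closure_smul hconn hS, K, hK, fun p hp q hq hpq => ?_⟩
  · rintro g hg _ ⟨w, hw, y, hy, rfl⟩
    exact ⟨g * w, mul_mem hg hw, y, hy, mul_smul _ _ _⟩
  obtain ⟨w, hw, hp', hq'⟩ : ∃ w ∈ Subgroup.closure S,
      p ∈ w • (C ∪ Set.range t) ∧ q ∈ w • (C ∪ Set.range t) := by
    rcases hpq with rfl | hpq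
    · obtain ⟨w, hw, y, hy, rfl⟩ := hp
      exact ⟨w, hw, Set.smul_mem_smul_set hy, Set.smul_mem_smul_set hy⟩
    · exact hA.exists_mem_smul_of_adj hconn hS hp hq hpq
  rw [Set.mem_smul_set_iff_inv_smul_mem] at hp' hq'
  obtain ⟨g, hg, hgp, hgq⟩ := hKC _ hp' _ hq'
    (hpq.imp (congrArg (w⁻¹ • ·)) (hA.adj_smul w⁻¹ _ _))
  exact ⟨g * w⁻¹, mul_mem (hΛ hg) (inv_mem hw), by rwa [mul_smul], by rwa [mul_smul]⟩

theorem exists_superset_adj (hC : IsCore T Λ C) (hA : IsTreeAction Γ T) {a b : X} (ha : a ∈ C)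
    (hab : T.Adj a b) : ∃ C', IsCore T Λ C' ∧ C ⊆ C' ∧ b ∈ C' := by
  have h := hC.closure_smul_union_range (L := Unit) (S := Λ) (o := fun _ => a) (t := fun _ => b) hA
    (fun _ => ha) (fun _ => hab) Subgroup.subset_closure fun s hs =>
      ⟨s • a, Or.inl (hC.smul_mem s hs a ha), Set.smul_mem_smul_set (Or.inl ha)⟩
  rw [Subgroup.closure_eq] at h
  exact ⟨_, h, fun x hx => ⟨1, one_mem _, x, Or.inl hx, one_smul _ _⟩,
    1, one_mem _, b, Or.inr ⟨(), rfl⟩, one_smul _ _⟩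

theorem exists_superset_mem (hC : IsCore T Λ C) (hA : IsTreeAction Γ T) (x : X) :
    ∃ C', IsCore T Λ C' ∧ C ⊆ C' ∧ x ∈ C' := by
  obtain ⟨p, hp⟩ := hC.connected.nonempty
  have h := (reachable_iff_reflTransGen _ _).1 (hA.isTree.connected.preconnected p x)
  induction h with
  | refl => exact ⟨C, hC, subset_rfl, hp⟩
  | tail _ hab ih =>
    obtain ⟨C', hC', hCC', ha⟩ := ih
    obtain ⟨C'', hC'', hCC'', hb⟩ := hC'.exists_superset_adj hA ha hab
    exact ⟨C'', hC'', hCC'.trans hCC'', hb⟩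

theorem exists_superset (hC : IsCore T Λ C) (hA : IsTreeAction Γ T) {S : Set X} (hS : S.Finite) :
    ∃ C', IsCore T Λ C' ∧ C ⊆ C' ∧ S ⊆ C' := by
  induction S, hS using Set.Finite.induction_on with
  | empty => exact ⟨C, hC, subset_rfl, Set.empty_subset _⟩
  | insert _ _ ih =>
    obtain ⟨C', hC', hCC', hSC'⟩ := ih
    obtain ⟨C'', hC'', hCC'', hx⟩ := hC'.exists_superset_mem hA _
    exact ⟨C'', hC'', hCC'.trans hCC'', Set.insert_subset hx (hSC'.trans hCC'')⟩

theorem finite_cosets_of_adj_mem_inter (hC : IsCore T Λ C) (hf : ActsFreely Λ X)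
    (hA : IsTreeAction Γ T) (hfin : ∀ x y : X, T.Adj x y → Finite (edgeStabilizer Γ x y))
    (hp : p ∈ C) :
    ((↑) '' {σ : Γ | p ∈ σ • C ∧ ∃ q ∈ C ∩ σ • C, T.Adj p q} : Set (Γ ⧸ Λ)).Finite := by
  obtain ⟨K, hK, hKC⟩ := hC.exists_finite
  have hsub : ((↑) '' {σ : Γ | p ∈ σ • C ∧ ∃ q ∈ C ∩ σ • C, T.Adj p q} : Set (Γ ⧸ Λ)) ⊆
      (↑) '' ⋃ q ∈ {q ∈ C | T.Adj p q}, ⋃ e ∈ {e ∈ K ×ˢ K | T.Adj e.1 e.2},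
        {m : Γ | m • e.1 = p ∧ m • e.2 = q} := by
    rintro _ ⟨σ, ⟨hpσ, q, ⟨hq, hqσ⟩, hpq⟩, rfl⟩
    rw [Set.mem_smul_set_iff_inv_smul_mem] at hpσ hqσ
    have hpq' : T.Adj (σ⁻¹ • p) (σ⁻¹ • q) := hA.adj_smul _ _ _ hpq
    obtain ⟨k, hk, hkp, hkq⟩ := hKC _ hpσ _ hqσ (Or.inr hpq')
    refine ⟨σ * k⁻¹, Set.mem_biUnion (show q ∈ {q ∈ C | T.Adj p q} from ⟨hq, hpq⟩)
      (Set.mem_biUnion (x := (k • σ⁻¹ • p, k • σ⁻¹ • q))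
        ⟨⟨hkp, hkq⟩, hA.adj_smul k _ _ hpq'⟩ ?_),
      QuotientGroup.eq.2 (by simpa only [mul_inv_rev, inv_inv, inv_mul_cancel_right] using hk)⟩
    simp only [Set.mem_ofPred_eq, mul_smul, inv_smul_smul, smul_inv_smul, and_self]
  refine Set.Finite.subset (Set.Finite.image _ ?_) hsub
  exact (hC.finite_neighbors hf hp).biUnion fun q _ => ((hK.prod hK).sep _).biUnion fun e he =>
    finite_smul_eq_smul_eq (hfin _ _ he.2) p q

theorem subsingleton_cosets_of_inter_eq_singleton (hC : IsCore T Λ C) (hf : ActsFreely Λ X)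
    (p : X) (d : Γ) :
    ((↑) '' {σ ∈ doubleCosets Λ {d} | C ∩ σ • C = {p}} : Set (Γ ⧸ Λ)).Subsingleton := by
  rintro _ ⟨_, ⟨⟨g, hg, _, rfl, h, hh, rfl⟩, hσ⟩, rfl⟩ _
    ⟨_, ⟨⟨g', hg', d, rfl, h', hh', rfl⟩, hσ'⟩, rfl⟩
  have hpσ : p ∈ C ∩ (g * d * h) • C := hσ ▸ rfl
  have hpσ' : p ∈ C ∩ (g' * d * h') • C := hσ' ▸ rfl
  have hk : g * g'⁻¹ ∈ Λ := mul_mem hg (inv_mem hg')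
  have hcoset : ((g * g'⁻¹ * (g' * d * h') : Γ) : Γ ⧸ Λ) = (g * d * h : Γ) :=
    QuotientGroup.eq.2 (by convert mul_mem (inv_mem hh') hh using 1; group)
  have hkp : (g * g'⁻¹) • p ∈ C ∩ (g * d * h) • C :=
    ⟨hC.smul_mem _ hk p hpσ.1, (hC.mem_smul_iff_of_mk_eq hcoset).1 (by
      rw [mul_smul]
      exact Set.smul_mem_smul_set hpσ'.2)⟩
  have hone : g * g'⁻¹ = 1 := hf _ hk p (by rwa [hσ] at hkp)
  rw [← hcoset, hone, one_mul]

theorem finite_cosets (hC : IsCore T Λ C) (hf : ActsFreely Λ X) (hA : IsTreeAction Γ T)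
    (hfin : ∀ x y : X, T.Adj x y → Finite (edgeStabilizer Γ x y)) (hD : D.Finite) (hp : p ∈ C) :
    ((↑) '' {σ ∈ doubleCosets Λ D | p ∈ σ • C} : Set (Γ ⧸ Λ)).Finite := by
  refine ((hC.finite_cosets_of_adj_mem_inter hf hA hfin hp).union (hD.biUnion fun d _ =>
    (hC.subsingleton_cosets_of_inter_eq_singleton hf p d).finite)).subset ?_
  rintro _ ⟨σ, ⟨⟨g, hg, d, hd, h, hh, rfl⟩, hpσ⟩, rfl⟩
  by_cases hex : ∃ x ∈ C ∩ (g * d * h) • C, x ≠ p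
  · obtain ⟨x, hx, hne⟩ := hex
    exact Or.inl ⟨_, ⟨hpσ, exists_adj_mem_inter hA.isTree hC.connected
      (hA.connected_induce_smul hC.connected _) ⟨hp, hpσ⟩ hx hne⟩, rfl⟩
  · push Not at hex
    exact Or.inr (Set.mem_biUnion hd ⟨_, ⟨⟨g, hg, d, rfl, h, hh, rfl⟩,
      Set.eq_singleton_iff_unique_mem.2 ⟨⟨hp, hpσ⟩, hex⟩⟩, rfl⟩)

theorem finite_smul_eq (hC : IsCore T Λ C) (hf : ActsFreely Λ X) (hA : IsTreeAction Γ T)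
    (hfin : ∀ x y : X, T.Adj x y → Finite (edgeStabilizer Γ x y)) (hD : D.Finite) (hp : p ∈ C)
    (hq : q ∈ C) : {σ ∈ doubleCosets Λ D | σ • p = q}.Finite := by
  refine Set.Finite.of_finite_image ((hC.finite_cosets hf hA hfin hD hq).subset
    (Set.image_mono ?_)) (f := ((↑) : Γ → Γ ⧸ Λ)) ?_
  · rintro σ ⟨hσ, rfl⟩
    exact ⟨hσ, Set.smul_mem_smul_set hp⟩
  · rintro σ ⟨-, hσ⟩ τ ⟨-, hτ⟩ hστ
    refine inv_mul_eq_one.1 (hf _ (QuotientGroup.eq.1 hστ) p ?_)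
    rw [mul_smul, hτ, ← hσ, inv_smul_smul]

/-- Such a neighbour lies in `C` or in a translate of `C` through `p`, by connectedness, and only
finitely many translates pass through `p`. -/
theorem finite_neighbors_smul (hC : IsCore T Λ C) (hf : ActsFreely Λ X) (hA : IsTreeAction Γ T)
    (hfin : ∀ x y : X, T.Adj x y → Finite (edgeStabilizer Γ x y)) (hD : D.Finite)
    (hΔ : Δ ⊆ doubleCosets Λ D) (hmeet : ∀ σ ∈ Δ, (C ∩ σ • C).Nonempty) (hp : p ∈ C) :
    {z | T.Adj p z ∧ ∃ σ ∈ Δ, z ∈ σ • C}.Finite := by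
  have hcoset : ∀ c ∈ ((↑) '' {σ ∈ doubleCosets Λ D | p ∈ σ • C} : Set (Γ ⧸ Λ)),
      {z | T.Adj p z ∧ ∃ σ : Γ, (σ : Γ ⧸ Λ) = c ∧ z ∈ σ • C}.Finite := by
    rintro _ ⟨m, ⟨-, hpm⟩, rfl⟩
    rw [Set.mem_smul_set_iff_inv_smul_mem] at hpm
    refine ((hC.finite_neighbors hf hpm).image (m • ·)).subset ?_
    rintro z ⟨hpz, σ, hσ, hz⟩
    rw [hC.mem_smul_iff_of_mk_eq hσ, Set.mem_smul_set_iff_inv_smul_mem] at hz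
    exact ⟨m⁻¹ • z, ⟨hz, hA.adj_smul _ _ _ hpz⟩, smul_inv_smul _ _⟩
  refine ((hC.finite_neighbors hf hp).union
    ((hC.finite_cosets hf hA hfin hD hp).biUnion hcoset)).subset ?_
  rintro z ⟨hpz, σ, hσ, hz⟩
  by_cases hzC : z ∈ C
  · exact Or.inl ⟨hzC, hpz⟩
  have hpσ : p ∈ σ • C := by
    by_contra hpσ
    obtain ⟨c, hc, hcσ⟩ := hmeet σ hσ
    exact notMem_halfTree_of_connected hA.isTree hC.connected hpz hp hzC hc
      (subset_halfTree_of_connected hA.isTree (hA.connected_induce_smul hC.connected σ) hpz hpσ hz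
        hcσ)
  exact Or.inr (Set.mem_biUnion ⟨σ, ⟨hΔ hσ, hpσ⟩, rfl⟩ ⟨hpz, σ, rfl, hz⟩)

end IsCore

/-! ### Symmetric unions of double cosets -/

/-- `Q` is invariant under inversion and a union of double cosets of `Λ`; such sets describe the
`Γ`-invariant symmetric relations on `Γ ⧸ Λ`. -/
structure IsSymmBiinvariant {Γ : Type*} [Group Γ] (Λ : Subgroup Γ) (Q : Set Γ) : Prop where
  mul_mem : ∀ σ ∈ Q, ∀ g ∈ Λ, ∀ h ∈ Λ, g * σ * h ∈ Q
  inv_mem : ∀ σ ∈ Q, σ⁻¹ ∈ Q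

namespace IsSymmBiinvariant

variable {Γ : Type*} [Group Γ] {Λ : Subgroup Γ} {Q Q' S : Set Γ} {σ g h : Γ}

theorem mul_mem_iff (hQ : IsSymmBiinvariant Λ Q) (hg : g ∈ Λ) (hh : h ∈ Λ) :
    g * σ * h ∈ Q ↔ σ ∈ Q :=
  ⟨fun hσ => by
    simpa [mul_assoc] using hQ.mul_mem _ hσ _ (Λ.inv_mem hg) _ (Λ.inv_mem hh),
    fun hσ => hQ.mul_mem σ hσ g hg h hh⟩

theorem coe (Λ : Subgroup Γ) : IsSymmBiinvariant Λ (Λ : Set Γ) :=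
  ⟨fun _ hσ _ hg _ hh => Λ.mul_mem (Λ.mul_mem hg hσ) hh, fun _ hσ => Λ.inv_mem hσ⟩

theorem empty (Λ : Subgroup Γ) : IsSymmBiinvariant Λ ∅ :=
  ⟨fun _ hσ => hσ.elim, fun _ hσ => hσ.elim⟩

theorem union (hQ : IsSymmBiinvariant Λ Q) (hQ' : IsSymmBiinvariant Λ Q') :
    IsSymmBiinvariant Λ (Q ∪ Q') :=
  ⟨fun σ hσ g hg h hh =>
    hσ.imp (fun hσ => hQ.mul_mem σ hσ g hg h hh) fun hσ => hQ'.mul_mem σ hσ g hg h hh,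
    fun σ hσ => hσ.imp (hQ.inv_mem σ) (hQ'.inv_mem σ)⟩

theorem doubleCosets (Λ : Subgroup Γ) (hS : ∀ s ∈ S, s⁻¹ ∈ S) :
    IsSymmBiinvariant Λ (doubleCosets Λ S) := by
  constructor
  · rintro _ ⟨k, hk, s, hs, k', hk', rfl⟩ g hg h hh
    exact ⟨g * k, Λ.mul_mem hg hk, s, hs, k' * h, Λ.mul_mem hk' hh, by group⟩
  · rintro _ ⟨k, hk, s, hs, k', hk', rfl⟩
    exact ⟨k'⁻¹, Λ.inv_mem hk', s⁻¹, hS s hs, k⁻¹, Λ.inv_mem hk, by group⟩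

theorem doubleCosets_union_inv (Λ : Subgroup Γ) (S : Set Γ) :
    IsSymmBiinvariant Λ (_root_.doubleCosets Λ (S ∪ S⁻¹)) :=
  .doubleCosets Λ fun _ hs => hs.symm.imp id Set.inv_mem_inv.2

theorem disjoint_coe (hQ : IsSymmBiinvariant Λ Q) (h1 : (1 : Γ) ∉ Q) :
    Disjoint (Λ : Set Γ) Q := Set.disjoint_left.2 fun g hg hgQ =>
  h1 (by simpa using hQ.mul_mem g hgQ _ (Λ.inv_mem hg) 1 (one_mem Λ))

theorem disjoint_doubleCosets_union_inv (hQ : IsSymmBiinvariant Λ Q) (hS : Disjoint Q S) :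
    Disjoint Q (_root_.doubleCosets Λ (S ∪ S⁻¹)) := by
  rw [Set.disjoint_left] at hS ⊢
  rintro _ hσ ⟨g, hg, s, hs | hs, h, hh, rfl⟩
  · exact hS ((hQ.mul_mem_iff hg hh).1 hσ) hs
  · exact hS (hQ.inv_mem _ ((hQ.mul_mem_iff hg hh).1 hσ)) hs

end IsSymmBiinvariant

theorem subset_doubleCosets {Γ : Type*} [Group Γ] (Λ : Subgroup Γ) (S : Set Γ) :
    S ⊆ doubleCosets Λ S := fun s hs => ⟨1, one_mem _, s, hs, 1, one_mem _, by group⟩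

theorem doubleCosets_mono {Γ : Type*} [Group Γ] (Λ : Subgroup Γ) {S S' : Set Γ} (hS : S ⊆ S') :
    doubleCosets Λ S ⊆ doubleCosets Λ S' := by
  rintro σ ⟨g, hg, s, hs, h⟩
  exact ⟨g, hg, s, hS hs, h⟩

theorem doubleCosets_subset_doubleCosets {Γ : Type*} [Group Γ] {Λ M : Subgroup Γ} {Q D : Set Γ}
    (hM : Λ ≤ M) (hQ : Q ⊆ doubleCosets Λ D) : doubleCosets M Q ⊆ doubleCosets M D := by
  rintro _ ⟨g, hg, σ, hσ, h, hh, rfl⟩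
  obtain ⟨k, hk, d, hd, k', hk', rfl⟩ := hQ hσ
  exact ⟨g * k, mul_mem hg (hM hk), d, hd, k' * h, mul_mem (hM hk') hh, by group⟩

/-- A core `C` of a free subgroup `Λ`, large enough to meet its translates by all elements of a
set `Δ` consisting of finitely many double cosets of `Λ`, among them `Λ` itself. -/
structure IsTame {Γ X : Type*} [Group Γ] [MulAction Γ X] (T : SimpleGraph X) (Λ : Subgroup Γ)
    (C : Set X) (Δ : Set Γ) : Prop where
  isCore : IsCore T Λ C
  actsFreely : ActsFreely Λ X
  le : (Λ : Set Γ) ⊆ Δ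
  isSymmBiinvariant : IsSymmBiinvariant Λ Δ
  exists_finite : ∃ D : Set Γ, D.Finite ∧ Δ ⊆ doubleCosets Λ D
  inter_nonempty : ∀ σ ∈ Δ, (C ∩ σ • C).Nonempty

/-! ### Gluing -/

/-- Letters `l` with inverses `bar l`, realized by elements `θ l` of `Γ`. The edge from `o l` to
`t l` leaves the core `C` of `Λ` at `t l`, and `θ l` moves `t (bar l)` to `t l`, folding the edges
at `bar l` and `l` head to head. -/
structure IsGluing {Γ X L : Type*} [Group Γ] [MulAction Γ X] (T : SimpleGraph X) (Λ : Subgroup Γ)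
    (C : Set X) (bar : L → L) (θ : L → Γ) (o t : L → X) : Prop where
  isCore : IsCore T Λ C
  bar_ne : ∀ l, bar l ≠ l
  map_bar : ∀ l, θ (bar l) = (θ l)⁻¹
  mem : ∀ l, o l ∈ C
  notMem : ∀ l, t l ∉ C
  adj : ∀ l, T.Adj (o l) (t l)
  smul_eq : ∀ l, θ l • t (bar l) = t l
  smul_ne : ∀ l, θ l • o (bar l) ≠ o l
  free : ∀ g ∈ Λ, ∀ l l', g • t l = t l' → g = 1 ∧ l = l'

/-- Reduced words in `Λ` and the letters `θ l` that start with the given letter. -/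
inductive IsReducedWord {Γ L : Type*} [Group Γ] (Λ : Subgroup Γ) (bar : L → L) (θ : L → Γ) :
    L → Γ → Prop
  | single (l : L) (g : Γ) (hg : g ∈ Λ) : IsReducedWord Λ bar θ l (θ l * g)
  | cons (l : L) (g : Γ) (hg : g ∈ Λ) (l' : L) (w : Γ) (hw : IsReducedWord Λ bar θ l' w)
      (h : g = 1 → l' ≠ bar l) : IsReducedWord Λ bar θ l (θ l * (g * w))

/-- The subgroup generated by `Λ` and the elements `θ l`. -/
def gluedSubgroup {Γ L : Type*} [Group Γ] (Λ : Subgroup Γ) (θ : L → Γ) : Subgroup Γ :=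
  Subgroup.closure ((Λ : Set Γ) ∪ Set.range θ)

section Words

variable {Γ L : Type*} [Group Γ] {Λ : Subgroup Γ} {bar : L → L} {θ : L → Γ} {l : L} {w : Γ}

theorem le_gluedSubgroup (Λ : Subgroup Γ) (θ : L → Γ) : Λ ≤ gluedSubgroup Λ θ :=
  fun _ hg => Subgroup.subset_closure (Or.inl hg)

theorem mem_gluedSubgroup (Λ : Subgroup Γ) (θ : L → Γ) (l : L) : θ l ∈ gluedSubgroup Λ θ :=
  Subgroup.subset_closure (Or.inr ⟨l, rfl⟩)

theorem IsReducedWord.mem_gluedSubgroup (hw : IsReducedWord Λ bar θ l w) :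
    w ∈ gluedSubgroup Λ θ := by
  induction hw with
  | single l g hg => exact mul_mem (_root_.mem_gluedSubgroup Λ θ l) (le_gluedSubgroup Λ θ hg)
  | cons l g hg _ _ _ _ ih =>
    exact mul_mem (_root_.mem_gluedSubgroup Λ θ l) (mul_mem (le_gluedSubgroup Λ θ hg) ih)

theorem mul_mem_or_isReducedWord (hθ : ∀ l, θ (bar l) = (θ l)⁻¹) (l : L)
    (hw : w ∈ Λ ∨ ∃ g ∈ Λ, ∃ l v, IsReducedWord Λ bar θ l v ∧ w = g * v) :
    θ l * w ∈ Λ ∨ ∃ g ∈ Λ, ∃ l' v, IsReducedWord Λ bar θ l' v ∧ θ l * w = g * v := by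
  rcases hw with hw | ⟨g, hg, l', v, hv, rfl⟩
  · exact Or.inr ⟨1, Λ.one_mem, l, _, .single l w hw, (one_mul _).symm⟩
  by_cases h : g = 1 → l' ≠ bar l
  · exact Or.inr ⟨1, Λ.one_mem, l, _, .cons l g hg l' v hv h, (one_mul _).symm⟩
  push Not at h
  obtain ⟨rfl, rfl⟩ := h
  cases hv with
  | single _ g hg => exact Or.inl (by rwa [hθ, one_mul, mul_inv_cancel_left])
  | cons _ g hg l' w hw h =>
    exact Or.inr ⟨g, hg, l', w, hw, by rw [hθ, one_mul, mul_inv_cancel_left]⟩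

theorem mem_or_isReducedWord (hθ : ∀ l, θ (bar l) = (θ l)⁻¹) (hw : w ∈ gluedSubgroup Λ θ) :
    w ∈ Λ ∨ ∃ g ∈ Λ, ∃ l v, IsReducedWord Λ bar θ l v ∧ w = g * v := by
  have hΛ : ∀ k ∈ Λ, ∀ w, (w ∈ Λ ∨ ∃ g ∈ Λ, ∃ l v, IsReducedWord Λ bar θ l v ∧ w = g * v) →
      (k * w ∈ Λ ∨ ∃ g ∈ Λ, ∃ l v, IsReducedWord Λ bar θ l v ∧ k * w = g * v) := by
    rintro k hk w (hw | ⟨g, hg, l, v, hv, rfl⟩)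
    · exact Or.inl (Λ.mul_mem hk hw)
    · exact Or.inr ⟨k * g, Λ.mul_mem hk hg, l, v, hv, (mul_assoc _ _ _).symm⟩
  induction hw using Subgroup.closure_induction_left with
  | one => exact Or.inl Λ.one_mem
  | mul_left x hx y _ ih =>
    rcases hx with hx | ⟨l, rfl⟩
    · exact hΛ x hx y ih
    · exact mul_mem_or_isReducedWord hθ l ih
  | inv_mul_cancel x hx y _ ih =>
    rcases hx with hx | ⟨l, rfl⟩
    · exact hΛ _ (Λ.inv_mem hx) y ih
    · exact hθ l ▸ mul_mem_or_isReducedWord hθ (bar l) ih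

end Words

namespace IsGluing

variable {Γ X L : Type*} [Group Γ] [MulAction Γ X] {T : SimpleGraph X} {Λ : Subgroup Γ} {C : Set X}
  {bar : L → L} {θ : L → Γ} {o t : L → X} {l l' : L} {x : X} {g w : Γ} {Δ Q : Set Γ}

theorem notMem_smul_halfTree (hG : IsGluing T Λ C bar θ o t) (hA : IsTreeAction Γ T) (hg : g ∈ Λ)
    (hx : x ∈ halfTree T (o l) (t l)) : g • x ∉ C := fun h =>
  notMem_halfTree_of_connected hA.isTree hG.isCore.connected (hG.adj l) (hG.mem l) (hG.notMem l)
    ((hG.isCore.smul_mem_iff hg).1 h) hx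

theorem eq_one_and_eq_of_smul_mem (hG : IsGluing T Λ C bar θ o t) (hA : IsTreeAction Γ T)
    (hg : g ∈ Λ) (hx : x ∈ halfTree T (o l) (t l)) (hgx : g • x ∈ halfTree T (o l') (t l')) :
    g = 1 ∧ l = l' :=
  hG.free g hg l l' (eq_of_mem_halfTree_of_mem_halfTree hA.isTree hG.isCore.connected
    (hG.isCore.smul_mem g hg _ (hG.mem l)) (fun h => hG.notMem l ((hG.isCore.smul_mem_iff hg).1 h))
    (hG.mem l') (hG.notMem l') (hA.adj_smul _ _ _ (hG.adj l)) (hG.adj l')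
    (hA.smul_mem_halfTree g hx) hgx).2

theorem letter_smul_mem (hG : IsGluing T Λ C bar θ o t) (hA : IsTreeAction Γ T)
    (hx : x ∉ halfTree T (o (bar l)) (t (bar l))) : θ l • x ∈ halfTree T (o l) (t l) := by
  have hadj := hA.adj_smul (θ l) _ _ (hG.adj (bar l)).symm
  have hmem := hA.smul_mem_halfTree (θ l)
    ((mem_halfTree_or_mem_halfTree hA.isTree _ _ x).resolve_left hx)
  rw [hG.smul_eq] at hadj hmem
  exact halfTree_subset_halfTree hA.isTree (hG.adj l) hadj (hG.smul_ne l).symm hmem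

/-- Ping-pong on the half-trees hanging off the core. -/
theorem reducedWord_smul_mem (hG : IsGluing T Λ C bar θ o t) (hA : IsTreeAction Γ T)
    (hw : IsReducedWord Λ bar θ l w) (hx : x ∈ C) : w • x ∈ halfTree T (o l) (t l) := by
  induction hw with
  | single l g hg =>
    rw [mul_smul]
    exact hG.letter_smul_mem hA fun h =>
      hG.notMem_smul_halfTree hA (one_mem Λ) h (by
        rw [one_smul]
        exact hG.isCore.smul_mem g hg x hx)
  | cons l g hg l' w _ hne ih =>
    rw [mul_smul, mul_smul]
    refine hG.letter_smul_mem hA fun h => ?_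
    obtain ⟨hone, hbar⟩ := hG.eq_one_and_eq_of_smul_mem hA hg ih h
    exact hne hone hbar

theorem eq_one_and_eq_of_adj_smul (hG : IsGluing T Λ C bar θ o t) (hA : IsTreeAction Γ T)
    (hg : g ∈ Λ) (hw : IsReducedWord Λ bar θ l' w) (hx : x ∈ C)
    (h : T.Adj (t l) (g • w • x)) : g = 1 ∧ l' = l := by
  have hwx := hG.reducedWord_smul_mem hA hw hx
  exact hG.eq_one_and_eq_of_smul_mem hA hg hwx
    (mem_halfTree_of_adj (right_mem_halfTree T _ _) h fun ho =>
      hG.notMem_smul_halfTree hA hg hwx (ho ▸ hG.mem l))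

theorem eq_one_of_smul_eq (hG : IsGluing T Λ C bar θ o t) (hA : IsTreeAction Γ T)
    (hw : w ∈ gluedSubgroup Λ θ) (h : w • t l = t l) : w = 1 := by
  rcases mem_or_isReducedWord hG.map_bar hw with hw | ⟨g, hg, l', v, hv, rfl⟩
  · exact (hG.free w hw l l h).1
  exfalso
  have hadj := hA.adj_smul (g * v) _ _ (hG.adj l).symm
  rw [h, mul_smul] at hadj
  obtain ⟨rfl, rfl⟩ := hG.eq_one_and_eq_of_adj_smul hA hg hv (hG.mem _) hadj
  have hbar : (θ l')⁻¹ • t l' = t (bar l') := by rw [inv_smul_eq_iff, hG.smul_eq]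
  rw [one_mul] at h
  cases hv with
  | single _ g hg =>
    rw [mul_smul, ← eq_inv_smul_iff, hbar] at h
    exact hG.bar_ne _ (hG.free g hg _ _ h).2.symm
  | cons _ g hg m u hu hne =>
    rw [mul_smul, ← eq_inv_smul_iff, hbar] at h
    have hadj' := hA.adj_smul (g * u) _ _ (hG.adj l').symm
    rw [h, mul_smul] at hadj'
    obtain ⟨hone, hm⟩ := hG.eq_one_and_eq_of_adj_smul hA hg hu (hG.mem _) hadj'
    exact hne hone hm

theorem isCore_gluedSubgroup [Finite L] (hG : IsGluing T Λ C bar θ o t) (hA : IsTreeAction Γ T) :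
    IsCore T (gluedSubgroup Λ θ) ((gluedSubgroup Λ θ : Set Γ) • (C ∪ Set.range t)) := by
  refine hG.isCore.closure_smul_union_range hA hG.mem hG.adj (le_gluedSubgroup Λ θ) ?_
  rintro s (hs | ⟨l, rfl⟩)
  · obtain ⟨c, hc⟩ := hG.isCore.connected.nonempty
    exact ⟨s • c, Or.inl (hG.isCore.smul_mem s hs c hc), Set.smul_mem_smul_set (Or.inl hc)⟩
  · exact ⟨t l, Or.inr ⟨l, rfl⟩, t (bar l), Or.inr ⟨bar l, rfl⟩, hG.smul_eq l⟩

theorem actsFreely_gluedSubgroup [Finite L] (hG : IsGluing T Λ C bar θ o t)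
    (hA : IsTreeAction Γ T) (hf : ActsFreely Λ X) : ActsFreely (gluedSubgroup Λ θ) X := by
  intro w hw z hz
  have hcore := hG.isCore_gluedSubgroup hA
  obtain ⟨_, ⟨u, hu, y, hy, rfl⟩, hwy⟩ :=
    hA.exists_mem_smul_eq_self hcore.connected (fun _ => hcore.smul_mem_iff hw) hz
  have hmem : u⁻¹ * w * u ∈ gluedSubgroup Λ θ := mul_mem (mul_mem (inv_mem hu) hw) hu
  have hfix : (u⁻¹ * w * u) • y = y := by
    rw [mul_smul, mul_smul, inv_smul_eq_iff]
    exact hwy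
  have hone : u⁻¹ * w * u = 1 := by
    rcases hy with hy | ⟨l, rfl⟩
    · rcases mem_or_isReducedWord hG.map_bar hmem with h | ⟨g, hg, l, v, hv, h⟩
      · exact hf _ h y hfix
      · rw [h, mul_smul] at hfix
        exact absurd hy
          (hfix ▸ hG.notMem_smul_halfTree hA hg (hG.reducedWord_smul_mem hA hv hy))
    · exact hG.eq_one_of_smul_eq hA hmem hfix
  rwa [mul_assoc, inv_mul_eq_one, eq_comm, mul_eq_right] at hone

theorem smul_head_notMem_union (hG : IsGluing T Λ C bar θ o t) (hΔ : IsTame T Λ C Δ)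
    (hout : ∀ σ ∈ Δ, ∀ l, σ • t l ∉ C) {σ : Γ} (hσ : σ ∈ Δ) (l : L) :
    t l ∉ C ∪ σ • C ∧ σ • t l ∉ C ∪ σ • C := by
  refine ⟨?_, ?_⟩ <;> rintro (h | h)
  · exact hG.notMem l h
  · exact hout σ⁻¹ (hΔ.isSymmBiinvariant.inv_mem σ hσ) l (Set.mem_smul_set_iff_inv_smul_mem.1 h)
  · exact hout σ hσ l h
  · exact hG.notMem l (Set.smul_mem_smul_set_iff.1 h)

theorem mul_reducedWord_notMem (hG : IsGluing T Λ C bar θ o t) (hA : IsTreeAction Γ T)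
    (hΔ : IsTame T Λ C Δ) (hout : ∀ σ ∈ Δ, ∀ l, σ • t l ∉ C) {σ v : Γ} (hσ : σ ∈ Δ)
    (hv : IsReducedWord Λ bar θ l v) : σ * v ∉ Δ := by
  intro h
  obtain ⟨_, hc', c, hc, rfl⟩ := hΔ.inter_nonempty _ h
  refine notMem_halfTree_of_connected hA.isTree
    (hΔ.isCore.connected_induce_union_smul hA (hΔ.inter_nonempty σ hσ))
    (hA.adj_smul σ _ _ (hG.adj l)) (Or.inr (Set.smul_mem_smul_set (hG.mem l)))
    (hG.smul_head_notMem_union hΔ hout hσ l).2 (Or.inl hc') ?_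
  change (σ * v) • c ∈ _
  rw [mul_smul]
  exact hA.smul_mem_halfTree σ (hG.reducedWord_smul_mem hA hv hc)

theorem mul_mul_mem_of_mem (hG : IsGluing T Λ C bar θ o t) (hA : IsTreeAction Γ T)
    (hΔ : IsTame T Λ C Δ) (hout : ∀ σ ∈ Δ, ∀ l, σ • t l ∉ C) (hQ : IsSymmBiinvariant Λ Q)
    (hQΔ : Q ⊆ Δ) {σ : Γ} (hg : g ∈ Λ) (hw : w ∈ gluedSubgroup Λ θ) (hσ : σ ∈ Q)
    (h : w * σ * g ∈ Δ) : w * σ * g ∈ Q := by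
  rcases mem_or_isReducedWord hG.map_bar hw with hw | ⟨k, hk, l, v, hv, rfl⟩
  · exact hQ.mul_mem σ hσ w hw g hg
  · have hsymm := hΔ.isSymmBiinvariant
    refine absurd ?_ (hG.mul_reducedWord_notMem hA hΔ hout
      (hsymm.inv_mem _ (hsymm.mul_mem _ h _ (inv_mem hk) 1 (one_mem Λ))) hv)
    convert hsymm.inv_mem _ (hsymm.mul_mem _ (hQΔ hσ) 1 (one_mem Λ) g hg) using 1
    group

theorem smul_edge_eq_of_mul_eq_mul (hG : IsGluing T Λ C bar θ o t) (hA : IsTreeAction Γ T)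
    (hΔ : IsTame T Λ C Δ) (hout : ∀ σ ∈ Δ, ∀ l, σ • t l ∉ C) {ρ τ v z : Γ} (hρ : ρ ∈ Δ)
    (hτ : τ ∈ Δ) (hv : IsReducedWord Λ bar θ l v) (hz : IsReducedWord Λ bar θ l' z)
    (h : ρ * v = z * τ) : ρ • o l = o l' ∧ ρ • t l = t l' := by
  obtain ⟨_, hc', c, hc, rfl⟩ := hΔ.inter_nonempty τ hτ
  have hzc := hG.reducedWord_smul_mem hA hz hc'
  have hvc := hA.smul_mem_halfTree ρ (hG.reducedWord_smul_mem hA hv hc)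
  rw [← mul_smul, h, mul_smul] at hvc
  exact eq_of_mem_halfTree_of_mem_halfTree hA.isTree
    (hΔ.isCore.connected_induce_union_smul hA (hΔ.inter_nonempty ρ hρ))
    (Or.inr (Set.smul_mem_smul_set (hG.mem l))) (hG.smul_head_notMem_union hΔ hout hρ l).2
    (Or.inl (hG.mem l')) (hG.smul_head_notMem_union hΔ hout hρ l').1
    (hA.adj_smul ρ _ _ (hG.adj l)) (hG.adj l') hvc hzc

theorem mul_letter_mem_of_mem (hG : IsGluing T Λ C bar θ o t) (hA : IsTreeAction Γ T)
    (hΔ : IsTame T Λ C Δ) (hout : ∀ σ ∈ Δ, ∀ l, σ • t l ∉ C) (hQ : IsSymmBiinvariant Λ Q)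
    (hQΔ : Q ⊆ Δ) (hQθ : ∀ σ ∈ Q, ∀ l l', σ • o l = o l' → σ • t l = t l' →
      (θ l')⁻¹ * σ * θ l ∈ Q) {σ u : Γ}
    (hu : ∀ w ∈ gluedSubgroup Λ θ, ∀ σ ∈ Q, w * σ * u ∈ Δ → w * σ * u ∈ Q)
    (hv : IsReducedWord Λ bar θ l (θ l * u)) (hg : g ∈ Λ) (hw : w ∈ gluedSubgroup Λ θ)
    (hσ : σ ∈ Q) (h : w * σ * (g * (θ l * u)) ∈ Δ) : w * σ * (g * (θ l * u)) ∈ Q := by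
  rcases mem_or_isReducedWord hG.map_bar (inv_mem hw) with hw' | ⟨k, hk, l', z, hz, hwz⟩
  · refine absurd ?_ (hG.mul_reducedWord_notMem hA hΔ hout
      (hQΔ (hQ.mul_mem σ hσ w (by simpa using inv_mem hw') g hg)) hv)
    simpa only [mul_assoc] using h
  · have hρ : k⁻¹ * σ * g ∈ Q := hQ.mul_mem σ hσ _ (inv_mem hk) g hg
    obtain rfl : w = z⁻¹ * k⁻¹ := by rw [← mul_inv_rev, ← hwz, inv_inv]
    obtain ⟨ho, ht⟩ := hG.smul_edge_eq_of_mul_eq_mul hA hΔ hout (hQΔ hρ) h hv hz (by group)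
    have hstep := hu (z⁻¹ * θ l')
      (mul_mem (inv_mem hz.mem_gluedSubgroup) (mem_gluedSubgroup Λ θ l'))
      _ (hQθ _ hρ l l' ho ht)
    have heq : z⁻¹ * θ l' * ((θ l')⁻¹ * (k⁻¹ * σ * g) * θ l) * u =
        z⁻¹ * k⁻¹ * σ * (g * (θ l * u)) := by group
    rw [heq] at hstep
    exact hstep h

theorem mem_of_mem_doubleCosets_gluedSubgroup (hG : IsGluing T Λ C bar θ o t)
    (hA : IsTreeAction Γ T) (hΔ : IsTame T Λ C Δ) (hout : ∀ σ ∈ Δ, ∀ l, σ • t l ∉ C)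
    (hQ : IsSymmBiinvariant Λ Q) (hQΔ : Q ⊆ Δ)
    (hQθ : ∀ σ ∈ Q, ∀ l l', σ • o l = o l' → σ • t l = t l' → (θ l')⁻¹ * σ * θ l ∈ Q)
    {τ : Γ} (hτ : τ ∈ Δ) (h : τ ∈ doubleCosets (gluedSubgroup Λ θ) Q) : τ ∈ Q := by
  have hreduced : ∀ l v, IsReducedWord Λ bar θ l v → ∀ g ∈ Λ, ∀ w ∈ gluedSubgroup Λ θ, ∀ σ ∈ Q,
      w * σ * (g * v) ∈ Δ → w * σ * (g * v) ∈ Q := by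
    intro l v hv
    induction hv with
    | single l k hk =>
      exact fun g hg w hw σ hσ => hG.mul_letter_mem_of_mem hA hΔ hout hQ hQΔ hQθ
        (fun w hw σ hσ => hG.mul_mul_mem_of_mem hA hΔ hout hQ hQΔ hk hw hσ) (.single l k hk) hg hw
        hσ
    | cons l k hk l' u hu hne ih =>
      exact fun g hg w hw σ hσ => hG.mul_letter_mem_of_mem hA hΔ hout hQ hQΔ hQθ (ih k hk)
        (.cons l k hk l' u hu hne) hg hw hσ
  obtain ⟨w, hw, σ, hσ, v, hv, rfl⟩ := h
  rcases mem_or_isReducedWord hG.map_bar hv with hv | ⟨g, hg, l, u, hu, rfl⟩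
  · exact hG.mul_mul_mem_of_mem hA hΔ hout hQ hQΔ hv hw hσ hτ
  · exact hreduced l u hu g hg w hw σ hσ hτ

end IsGluing

/-! ### Branches -/

/-- A group acting on a tree with finite edge stabilizers and a distinguished edge whose stabilizer
is highly core-free at its end `x₀`, while its other end `y₀` is fixed by an element moving `x₀`. -/
structure IsAdmissible (Γ : Type*) {X : Type*} [Group Γ] [MulAction Γ X] (T : SimpleGraph X)
    (x₀ y₀ : X) : Prop extends IsTreeAction Γ T where
  finite_edgeStabilizer : ∀ x y : X, T.Adj x y → Finite (edgeStabilizer Γ x y)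
  adj : T.Adj x₀ y₀
  isHighlyCoreFree :
    ((edgeStabilizer Γ x₀ y₀).subgroupOf (MulAction.stabilizer Γ x₀)).IsHighlyCoreFree
  exists_smul_ne : ∃ k : Γ, k • y₀ = y₀ ∧ k • x₀ ≠ x₀

/-- Edges `(c l)⁻¹ (x₀, u l y₀)` that leave the core `C` and all its translates by `Δ`. An element
of `Δ` maps the edge at `l` to the edge at `l'` only if it is `(c l')⁻¹ (c l)` and `l`, `l'` lie in
the same summand of the index type. -/
structure IsBranching {Γ X ι ι' : Type*} [Group Γ] [MulAction Γ X] (T : SimpleGraph X)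
    (Λ : Subgroup Γ) (C : Set X) (Δ : Set Γ) (x₀ y₀ : X) (c u : ι ⊕ ι' → Γ) : Prop where
  isTame : IsTame T Λ C Δ
  mem : ∀ l, (c l)⁻¹ • x₀ ∈ C
  smul_eq : ∀ l, u l • x₀ = x₀
  smul_notMem : ∀ σ ∈ Δ, ∀ l, σ • (c l)⁻¹ • u l • y₀ ∉ C
  rigid : ∀ σ ∈ Δ, ∀ l l', σ • (c l)⁻¹ • x₀ = (c l')⁻¹ • x₀ →
    σ • (c l)⁻¹ • u l • y₀ = (c l')⁻¹ • u l' • y₀ → l.isLeft = l'.isLeft ∧ σ = (c l')⁻¹ * c l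

theorem exists_smul_notMem_of_isHighlyCoreFree {Γ X : Type*} [Group Γ] [MulAction Γ X] {x y : X}
    (hxy : ((edgeStabilizer Γ x y).subgroupOf (MulAction.stabilizer Γ x)).IsHighlyCoreFree)
    {Y : Set X} (hY : Y.Finite) {W : Set Γ} (hW : W.Finite) :
    ∃ h : Γ, h • x = x ∧ h • y ∉ Y ∧ ∀ w ∈ W, w • x = x → w • h • y = h • y → w = 1 := by
  classical
  let H := MulAction.stabilizer Γ x
  obtain ⟨K, -, hKY⟩ := Set.exists_subset_bijOn ((fun k : H => k⁻¹ • y) ⁻¹' Y) fun k => k⁻¹ • y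
  have hK : K.Finite := hKY.finite_iff_finite.2 (hY.subset (Set.image_preimage_subset _ _))
  have hW' : {w : H | (w : Γ) ∈ W}.Finite := hW.preimage Subtype.val_injective.injOn
  obtain ⟨g, hgF, hgcosets⟩ := hxy ({1} ∪ hW'.toFinset ∪ hK.toFinset)
  have hmem : ∀ s : H, s • y = y → s ∈ (edgeStabilizer Γ x y).subgroupOf H := fun s hs =>
    Subgroup.mem_subgroupOf.2 (Subgroup.mem_inf.2 ⟨s.2, hs⟩)
  refine ⟨(g⁻¹ : H), (g⁻¹).2, fun hgY => ?_, fun w hw hwx hwy => ?_⟩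
  · obtain ⟨k, hk, hkg⟩ := hKY.surjOn ⟨g, hgY, rfl⟩
    have hgk : (g * k⁻¹) • y = y := by
      rw [mul_smul, show k⁻¹ • y = g⁻¹ • y from hkg, smul_inv_smul]
    exact hgF 1 (by simp) k (by simp [hk]) _ (hmem _ hgk) (by group)
  · by_contra hne
    let w' : H := ⟨w, hwx⟩
    have hgw : (g * w' * g⁻¹) • y = y := by
      rw [mul_smul, mul_smul, show w' • g⁻¹ • y = g⁻¹ • y from hwy, smul_inv_smul]
    exact hgcosets w' (Finset.mem_union_left _ (Finset.mem_union_right _ (hW'.mem_toFinset.2 hw))) 1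
      (by simp) (fun h => hne (congrArg Subtype.val h)) 1 (one_mem _) _ (hmem _ hgw) (by group)

namespace IsAdmissible

variable {Γ X : Type*} [Group Γ] [MulAction Γ X] {T : SimpleGraph X} {x₀ y₀ x : X}
  {Λ : Subgroup Γ} {C Y : Set X} {Δ : Set Γ} {u v k : Γ}

theorem adj_smul_right (hΓ : IsAdmissible Γ T x₀ y₀) (hu : u • x₀ = x₀) : T.Adj x₀ (u • y₀) := by
  simpa only [hu] using hΓ.adj_smul u _ _ hΓ.adj

theorem smul_mem_halfTree_of_notMem (hΓ : IsAdmissible Γ T x₀ y₀) (hu : u • x₀ = x₀)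
    (hv : v • x₀ = x₀) (hk : k • y₀ = y₀) (hkx : k • x₀ ≠ x₀) (hx : x ∉ halfTree T x₀ (v • y₀)) :
    (u * k * v⁻¹) • x ∈ halfTree T x₀ (u • y₀) := by
  have hmem := hΓ.smul_mem_halfTree (u * k * v⁻¹)
    ((mem_halfTree_or_mem_halfTree hΓ.isTree _ _ x).resolve_left hx)
  have hy : (u * k * v⁻¹) • v • y₀ = u • y₀ := by rw [mul_smul, inv_smul_smul, mul_smul, hk]
  have hx₀ : (u * k * v⁻¹) • x₀ = u • k • x₀ := by
    rw [mul_smul, inv_smul_eq_iff.2 hv.symm, mul_smul]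
  have hadj := hΓ.adj_smul u _ _ (hΓ.adj_smul k _ _ hΓ.adj).symm
  rw [hk] at hadj
  rw [hy, hx₀] at hmem
  exact halfTree_subset_halfTree hΓ.isTree (hΓ.adj_smul_right hu) hadj
    (fun h => hkx (smul_left_cancel u (h.symm.trans hu.symm))) hmem

theorem finite_smul_eq (hΓ : IsAdmissible Γ T x₀ y₀) (hΔ : IsTame T Λ C Δ) {p q : X} (hp : p ∈ C)
    (hq : q ∈ C) : {σ ∈ Δ | σ • p = q}.Finite := by
  obtain ⟨D, hD, hΔD⟩ := hΔ.exists_finite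
  exact (hΔ.isCore.finite_smul_eq hΔ.actsFreely hΓ.toIsTreeAction hΓ.finite_edgeStabilizer hD hp
    hq).subset fun σ hσ => ⟨hΔD hσ.1, hσ.2⟩

theorem exists_branch (hΓ : IsAdmissible Γ T x₀ y₀) (hΔ : IsTame T Λ C Δ) {ι : Type*} [Finite ι]
    {c : ι → Γ} (hc : ∀ i, (c i)⁻¹ • x₀ ∈ C) (hY : Y.Finite) :
    ∃ u : Γ, u • x₀ = x₀ ∧ u • y₀ ∉ Y ∧ (∀ σ ∈ Δ, ∀ i, σ • (c i)⁻¹ • u • y₀ ∉ C) ∧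
      ∀ σ ∈ Δ, ∀ i j, σ • (c i)⁻¹ • x₀ = (c j)⁻¹ • x₀ →
        σ • (c i)⁻¹ • u • y₀ = (c j)⁻¹ • u • y₀ → σ = (c j)⁻¹ * c i := by
  obtain ⟨D, hD, hΔD⟩ := hΔ.exists_finite
  have hY' : (Y ∪ ⋃ i, (c i • ·) '' {z | T.Adj ((c i)⁻¹ • x₀) z ∧ ∃ σ ∈ Δ, z ∈ σ • C}).Finite :=
    hY.union (Set.finite_iUnion fun i =>
      (hΔ.isCore.finite_neighbors_smul hΔ.actsFreely hΓ.toIsTreeAction hΓ.finite_edgeStabilizer hD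
        hΔD hΔ.inter_nonempty (hc i)).image _)
  have hW : (⋃ i, ⋃ j, (fun σ => c j * σ * (c i)⁻¹) ''
      {σ ∈ Δ | σ • (c i)⁻¹ • x₀ = (c j)⁻¹ • x₀}).Finite :=
    Set.finite_iUnion fun i => Set.finite_iUnion fun j =>
      (hΓ.finite_smul_eq hΔ (hc i) (hc j)).image _
  obtain ⟨u, hu, huY, huW⟩ := exists_smul_notMem_of_isHighlyCoreFree hΓ.isHighlyCoreFree hY' hW
  refine ⟨u, hu, fun hmem => huY (Or.inl hmem), fun σ hσ i hmem => huY (Or.inr ?_),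
    fun σ hσ i j hx hy => ?_⟩
  · exact Set.mem_iUnion.2 ⟨i, (c i)⁻¹ • u • y₀, ⟨hΓ.adj_smul _ _ _ (hΓ.adj_smul_right hu), σ⁻¹,
      hΔ.isSymmBiinvariant.inv_mem σ hσ, Set.mem_inv_smul_set_iff.2 hmem⟩, smul_inv_smul _ _⟩
  · have hone := huW _ (Set.mem_iUnion₂.2 ⟨i, j, σ, ⟨hσ, hx⟩, rfl⟩)
      (by rw [mul_smul, mul_smul, hx, smul_inv_smul])
      (by rw [mul_smul, mul_smul, hy, smul_inv_smul])
    rw [mul_inv_eq_one] at hone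
    rw [← hone, inv_mul_cancel_left]

theorem exists_isBranching (hΓ : IsAdmissible Γ T x₀ y₀) (hΔ : IsTame T Λ C Δ) {ι ι' : Type*}
    [Finite ι] [Finite ι'] {c : ι ⊕ ι' → Γ} (hc : ∀ l, (c l)⁻¹ • x₀ ∈ C) :
    ∃ u v : Γ, u • x₀ = x₀ ∧ v • x₀ = x₀ ∧
      IsBranching T Λ C Δ x₀ y₀ c (Sum.elim (fun _ => u) fun _ => v) := by
  obtain ⟨u, hu, -, huC, hurigid⟩ := hΓ.exists_branch hΔ (fun i => hc (.inl i)) Set.finite_empty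
  have hY : (⋃ i, ⋃ j, (fun σ => c (.inr j) • σ • (c (.inl i))⁻¹ • u • y₀) ''
      {σ ∈ Δ | σ • (c (.inl i))⁻¹ • x₀ = (c (.inr j))⁻¹ • x₀}).Finite :=
    Set.finite_iUnion fun i => Set.finite_iUnion fun j =>
      (hΓ.finite_smul_eq hΔ (hc (.inl i)) (hc (.inr j))).image _
  obtain ⟨v, hv, hvY, hvC, hvrigid⟩ := hΓ.exists_branch hΔ (fun i => hc (.inr i)) hY
  have hcross : ∀ σ ∈ Δ, ∀ i j, σ • (c (.inl i))⁻¹ • x₀ = (c (.inr j))⁻¹ • x₀ →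
      σ • (c (.inl i))⁻¹ • u • y₀ ≠ (c (.inr j))⁻¹ • v • y₀ := by
    intro σ hσ i j hx hy
    refine hvY (Set.mem_iUnion₂.2 ⟨i, j, σ, ⟨hσ, hx⟩, ?_⟩)
    change c (.inr j) • σ • (c (.inl i))⁻¹ • u • y₀ = v • y₀
    rw [hy, smul_inv_smul]
  refine ⟨u, v, hu, hv, hΔ, hc, ?_, ?_, ?_⟩
  · rintro (_ | _)
    exacts [hu, hv]
  · rintro σ hσ (i | i)
    exacts [huC σ hσ i, hvC σ hσ i]
  · rintro σ hσ (i | i) (j | j) hx hy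
    · exact ⟨rfl, hurigid σ hσ i j hx hy⟩
    · exact absurd hy (hcross σ hσ i j hx)
    · exact absurd (inv_smul_eq_iff.2 hy.symm) (hcross σ⁻¹ (hΔ.isSymmBiinvariant.inv_mem σ hσ) j i
        (inv_smul_eq_iff.2 hx.symm))
    · exact ⟨rfl, hvrigid σ hσ i j hx hy⟩

end IsAdmissible

namespace IsBranching

variable {Γ X ι ι' : Type*} [Group Γ] [MulAction Γ X] {T : SimpleGraph X} {Λ : Subgroup Γ}
  {C : Set X} {Δ : Set Γ} {x₀ y₀ x : X} {c u : ι ⊕ ι' → Γ} {l l' : ι ⊕ ι'} {g g' h h' k : Γ}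

theorem adj (hB : IsBranching T Λ C Δ x₀ y₀ c u) (hΓ : IsAdmissible Γ T x₀ y₀) (l : ι ⊕ ι') :
    T.Adj ((c l)⁻¹ • x₀) ((c l)⁻¹ • u l • y₀) :=
  hΓ.adj_smul _ _ _ (hΓ.adj_smul_right (hB.smul_eq l))

theorem notMem (hB : IsBranching T Λ C Δ x₀ y₀ c u) (l : ι ⊕ ι') : (c l)⁻¹ • u l • y₀ ∉ C := by
  simpa only [one_smul] using hB.smul_notMem 1 (hB.isTame.le (one_mem Λ)) l

theorem notMem_halfTree (hB : IsBranching T Λ C Δ x₀ y₀ c u) (hΓ : IsAdmissible Γ T x₀ y₀)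
    (l : ι ⊕ ι') (hx : x ∈ C) : x ∉ halfTree T ((c l)⁻¹ • x₀) ((c l)⁻¹ • u l • y₀) :=
  notMem_halfTree_of_connected hΓ.isTree hB.isTame.isCore.connected (hB.adj hΓ l) (hB.mem l)
    (hB.notMem l) hx

theorem eq_of_mem_halfTree (hB : IsBranching T Λ C Δ x₀ y₀ c u) (hΓ : IsAdmissible Γ T x₀ y₀)
    (hg : g ∈ Λ) (hx : x ∈ halfTree T ((c l)⁻¹ • x₀) ((c l)⁻¹ • u l • y₀))
    (hgx : g • x ∈ halfTree T ((c l')⁻¹ • x₀) ((c l')⁻¹ • u l' • y₀)) :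
    l.isLeft = l'.isLeft ∧ g = (c l')⁻¹ * c l := by
  have hC := hB.isTame.isCore
  obtain ⟨ho, ht⟩ := eq_of_mem_halfTree_of_mem_halfTree hΓ.isTree hC.connected
    (hC.smul_mem g hg _ (hB.mem l)) (fun h => hB.notMem l ((hC.smul_mem_iff hg).1 h)) (hB.mem l')
    (hB.notMem l') (hΓ.adj_smul _ _ _ (hB.adj hΓ l)) (hB.adj hΓ l') (hΓ.smul_mem_halfTree g hx) hgx
  exact hB.rigid g (hB.isTame.le hg) l l' ho ht

theorem mapsTo_halfTree (hB : IsBranching T Λ C Δ x₀ y₀ c u) (hΓ : IsAdmissible Γ T x₀ y₀)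
    (hk : k • y₀ = y₀) (hkx : k • x₀ ≠ x₀) (l l' : ι ⊕ ι') :
    Set.MapsTo (((c l)⁻¹ * (u l * k * (u l')⁻¹) * c l') • ·) C
      (halfTree T ((c l)⁻¹ • x₀) ((c l)⁻¹ • u l • y₀)) := fun x hx => by
  change ((c l)⁻¹ * (u l * k * (u l')⁻¹) * c l') • x ∈ _
  rw [mul_smul, mul_smul]
  refine hΓ.smul_mem_halfTree _ (hΓ.smul_mem_halfTree_of_notMem (hB.smul_eq l) (hB.smul_eq l') hk
    hkx fun hmem => hB.notMem_halfTree hΓ l' hx ?_)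
  simpa only [inv_smul_smul] using hΓ.smul_mem_halfTree (c l')⁻¹ hmem

theorem notMem_of_mapsTo_halfTree (hB : IsBranching T Λ C Δ x₀ y₀ c u)
    (hΓ : IsAdmissible Γ T x₀ y₀)
    (hg : Set.MapsTo (g • ·) C (halfTree T ((c l)⁻¹ • x₀) ((c l)⁻¹ • u l • y₀))) : g ∉ Δ := by
  intro hgΔ
  obtain ⟨_, hxC, x, hx, rfl⟩ := hB.isTame.inter_nonempty g hgΔ
  exact hB.notMem_halfTree hΓ l hxC (hg hx)

theorem eq_of_mapsTo_halfTree (hB : IsBranching T Λ C Δ x₀ y₀ c u) (hΓ : IsAdmissible Γ T x₀ y₀)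
    (hg : Set.MapsTo (g • ·) C (halfTree T ((c l)⁻¹ • x₀) ((c l)⁻¹ • u l • y₀)))
    (hg' : Set.MapsTo (g' • ·) C (halfTree T ((c l')⁻¹ • x₀) ((c l')⁻¹ • u l' • y₀)))
    (hh : h ∈ Λ) (hh' : h' ∈ Λ) (heq : h * g * h' = g') :
    l.isLeft = l'.isLeft ∧ h = (c l')⁻¹ * c l := by
  have hx := hB.mem l
  refine hB.eq_of_mem_halfTree hΓ hh (hg (hB.isTame.isCore.smul_mem h' hh' _ hx)) ?_
  simpa only [← heq, mul_smul] using hg' hx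

end IsBranching

/-! ### Approximations -/

/-- A finite approximation of a `Γ`-invariant graph on a quotient of `Γ`: a subgroup `Λ` acting
freely and cocompactly on a subtree through `x₀`, and finitely many double cosets of `Λ` declared
to be edges (`P`) or non-edges (`N`). -/
structure Approx (Γ : Type*) {X : Type*} [Group Γ] [MulAction Γ X] (T : SimpleGraph X)
    (x₀ : X) where
  Λ : Subgroup Γ
  P : Set Γ
  N : Set Γ
  actsFreely : ActsFreely Λ X
  exists_isCore : ∃ C, IsCore T Λ C ∧ x₀ ∈ C
  isSymmBiinvariant_P : IsSymmBiinvariant Λ P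
  isSymmBiinvariant_N : IsSymmBiinvariant Λ N
  disjoint_Λ_P : Disjoint (Λ : Set Γ) P
  disjoint_Λ_N : Disjoint (Λ : Set Γ) N
  disjoint_P_N : Disjoint P N
  exists_finite : ∃ D : Set Γ, D.Finite ∧ P ∪ N ⊆ doubleCosets Λ D

namespace Approx

variable {Γ X : Type*} [Group Γ] [MulAction Γ X] {T : SimpleGraph X} {x₀ y₀ : X}

instance : Preorder (Approx Γ T x₀) where
  le a b := a.Λ ≤ b.Λ ∧ a.P ⊆ b.P ∧ a.N ⊆ b.N
  le_refl a := ⟨le_rfl, subset_rfl, subset_rfl⟩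
  le_trans a b c h h' := ⟨h.1.trans h'.1, h.2.1.trans h'.2.1, h.2.2.trans h'.2.2⟩

instance : Inhabited (Approx Γ T x₀) where
  default :=
    { Λ := ⊥
      P := ∅
      N := ∅
      actsFreely := fun _ hg _ _ => Subgroup.mem_bot.1 hg
      exists_isCore := ⟨{x₀}, isCore_bot_singleton T x₀, rfl⟩
      isSymmBiinvariant_P := .empty ⊥
      isSymmBiinvariant_N := .empty ⊥
      disjoint_Λ_P := Set.disjoint_empty _
      disjoint_Λ_N := Set.disjoint_empty _
      disjoint_P_N := Set.disjoint_empty _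
      exists_finite := ⟨∅, Set.finite_empty, by simp⟩ }

/-- The elements whose double coset has been decided to consist of equal, adjacent or distinct
non-adjacent pairs. -/
def decided (a : Approx Γ T x₀) : Set Γ := a.P ∪ a.N ∪ a.Λ

theorem decided_mono {a b : Approx Γ T x₀} (h : a ≤ b) : a.decided ⊆ b.decided :=
  Set.union_subset_union (Set.union_subset_union h.2.1 h.2.2) h.1

theorem mem_N_iff (a : Approx Γ T x₀) {σ : Γ} (hσ : σ ∈ a.decided) :
    σ ∈ a.N ↔ σ ∉ a.P ∧ σ ∉ a.Λ :=
  ⟨fun h => ⟨Set.disjoint_right.1 a.disjoint_P_N h, Set.disjoint_right.1 a.disjoint_Λ_N h⟩,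
    fun h => (hσ.resolve_right h.2).resolve_left h.1⟩

theorem isSymmBiinvariant_decided (a : Approx Γ T x₀) : IsSymmBiinvariant a.Λ a.decided :=
  (a.isSymmBiinvariant_P.union a.isSymmBiinvariant_N).union (.coe a.Λ)

theorem exists_finite_decided_subset (a : Approx Γ T x₀) :
    ∃ D : Set Γ, D.Finite ∧ a.decided ⊆ doubleCosets a.Λ D := by
  obtain ⟨D, hD, hPN⟩ := a.exists_finite
  refine ⟨insert 1 D, hD.insert 1, Set.union_subset
    (hPN.trans (doubleCosets_mono a.Λ (Set.subset_insert 1 D))) fun g hg => ?_⟩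
  exact ⟨g, hg, 1, Set.mem_insert 1 D, 1, one_mem _, by group⟩

theorem exists_isTame (hΓ : IsTreeAction Γ T) (a : Approx Γ T x₀) {S : Set X} (hS : S.Finite) :
    ∃ C, IsTame T a.Λ C a.decided ∧ x₀ ∈ C ∧ S ⊆ C := by
  obtain ⟨C₀, hC₀, hx₀⟩ := a.exists_isCore
  obtain ⟨D, hD, hdecided⟩ := a.exists_finite_decided_subset
  obtain ⟨C, hC, hC₀C, hCS⟩ := hC₀.exists_superset hΓ (hS.union (hD.image (· • x₀)))
  refine ⟨C, ⟨hC, a.actsFreely, Set.subset_union_right, a.isSymmBiinvariant_decided,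
    ⟨D, hD, hdecided⟩, fun σ hσ => ?_⟩, hC₀C hx₀, Set.subset_union_left.trans hCS⟩
  obtain ⟨g, hg, d, hd, h, hh, rfl⟩ := hdecided hσ
  refine ⟨g • d • x₀, hC.smul_mem g hg _ (hCS (Or.inr ⟨d, hd, rfl⟩)), h⁻¹ • x₀,
    hC.smul_mem _ (inv_mem hh) _ (hC₀C hx₀), ?_⟩
  change (g * d * h) • h⁻¹ • x₀ = g • d • x₀
  rw [mul_smul, mul_smul, smul_inv_smul]

theorem exists_le_subset_P_subset_N (a : Approx Γ T x₀) {A B : Set Γ} (hA : A.Finite)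
    (hB : B.Finite) (hA' : Disjoint (a.N ∪ a.Λ) A) (hB' : Disjoint (a.P ∪ a.Λ) B)
    (hAB : Disjoint (doubleCosets a.Λ (A ∪ A⁻¹)) B) :
    ∃ b, a ≤ b ∧ b.Λ = a.Λ ∧ A ⊆ b.P ∧ B ⊆ b.N := by
  have hsymm := IsSymmBiinvariant.doubleCosets_union_inv a.Λ
  rw [Set.disjoint_union_left] at hA' hB'
  have hsubset (S : Set Γ) : S ⊆ doubleCosets a.Λ (S ∪ S⁻¹) :=
    Set.subset_union_left.trans (subset_doubleCosets _ _)
  obtain ⟨D, hD, hPN⟩ := a.exists_finite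
  let b : Approx Γ T x₀ :=
    { Λ := a.Λ
      P := a.P ∪ doubleCosets a.Λ (A ∪ A⁻¹)
      N := a.N ∪ doubleCosets a.Λ (B ∪ B⁻¹)
      actsFreely := a.actsFreely
      exists_isCore := a.exists_isCore
      isSymmBiinvariant_P := a.isSymmBiinvariant_P.union (hsymm A)
      isSymmBiinvariant_N := a.isSymmBiinvariant_N.union (hsymm B)
      disjoint_Λ_P := a.disjoint_Λ_P.union_right
        ((IsSymmBiinvariant.coe a.Λ).disjoint_doubleCosets_union_inv hA'.2)
      disjoint_Λ_N := a.disjoint_Λ_N.union_right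
        ((IsSymmBiinvariant.coe a.Λ).disjoint_doubleCosets_union_inv hB'.2)
      disjoint_P_N := Set.disjoint_union_left.2
        ⟨a.disjoint_P_N.union_right (a.isSymmBiinvariant_P.disjoint_doubleCosets_union_inv hB'.1),
          (a.isSymmBiinvariant_N.disjoint_doubleCosets_union_inv hA'.1).symm.union_right
            ((hsymm A).disjoint_doubleCosets_union_inv hAB)⟩
      exists_finite := by
        refine ⟨D ∪ (A ∪ A⁻¹ ∪ (B ∪ B⁻¹)),
          hD.union ((hA.union hA.inv).union (hB.union hB.inv)), ?_⟩
        refine Set.union_subset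
          (Set.union_subset (Set.subset_union_left.trans (hPN.trans ?_)) ?_)
          (Set.union_subset (Set.subset_union_right.trans (hPN.trans ?_)) ?_) <;>
          exact doubleCosets_mono a.Λ (by grind) }
  exact ⟨b, ⟨le_rfl, Set.subset_union_left, Set.subset_union_left⟩, rfl,
    (hsubset A).trans Set.subset_union_right, (hsubset B).trans Set.subset_union_right⟩

theorem exists_le_mem_decided (a : Approx Γ T x₀) (g : Γ) :
    ∃ b, a ≤ b ∧ b.Λ = a.Λ ∧ g ∈ b.decided := by
  by_cases hg : g ∈ a.decided
  · exact ⟨a, le_rfl, rfl, hg⟩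
  obtain ⟨b, hab, hΛ, -, hb⟩ := a.exists_le_subset_P_subset_N (A := ∅) (B := {g}) Set.finite_empty
    (Set.finite_singleton g) (Set.disjoint_empty _)
    (Set.disjoint_singleton_right.2 fun h => hg (h.imp_left Or.inl))
    (Set.disjoint_singleton_right.2 fun ⟨_, _, _, hs, _⟩ => by simp at hs)
  exact ⟨b, hab, hΛ, Or.inl (Or.inr (hb rfl))⟩

theorem exists_le_subset_decided (a : Approx Γ T x₀) {S : Set Γ} (hS : S.Finite) :
    ∃ b, a ≤ b ∧ S ⊆ b.decided := by
  induction S, hS using Set.Finite.induction_on with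
  | empty => exact ⟨a, le_rfl, Set.empty_subset _⟩
  | insert _ _ ih =>
    obtain ⟨b, hab, hb⟩ := ih
    obtain ⟨c, hbc, -, hc⟩ := b.exists_le_mem_decided _
    exact ⟨c, hab.trans hbc, Set.insert_subset hc (hb.trans (decided_mono hbc))⟩

end Approx

/-! ### Density -/

namespace Approx

variable {Γ X : Type*} [Group Γ] [MulAction Γ X] {T : SimpleGraph X} {x₀ y₀ : X}

theorem exists_separating (hΓ : IsAdmissible Γ T x₀ y₀) (a : Approx Γ T x₀) {F : Set Γ}
    (hF : F.Finite) :
    ∃ z : Γ, (∀ g ∈ F, z⁻¹ * g ∉ a.decided) ∧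
      (∀ g ∈ F, ∀ g' ∈ F, ∀ h ∈ a.Λ, ∀ h' ∈ a.Λ, h * (z⁻¹ * g) * h' = z⁻¹ * g' → g * h' = g') ∧
      ∀ g ∈ F, ∀ g' ∈ F, ∀ h ∈ a.Λ, ∀ h' ∈ a.Λ, h * (z⁻¹ * g)⁻¹ * h' ≠ z⁻¹ * g' := by
  obtain ⟨C, hΔ, hx₀, hFC⟩ := a.exists_isTame hΓ.toIsTreeAction (hF.image fun g => g⁻¹ • x₀)
  have := hF.to_subtype
  let c : F ⊕ Unit → Γ := Sum.elim (↑) fun _ => 1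
  have hc : ∀ l, (c l)⁻¹ • x₀ ∈ C := by
    rintro (g | -)
    exacts [hFC ⟨g, g.2, rfl⟩, by simpa [c] using hx₀]
  obtain ⟨u, v, -, -, hB⟩ := hΓ.exists_isBranching hΔ hc
  obtain ⟨k, hk, hkx⟩ := hΓ.exists_smul_ne
  have hout (g : F) := hB.mapsTo_halfTree hΓ hk hkx (.inl g) (.inr ())
  have hin (g : F) := hB.mapsTo_halfTree hΓ (inv_smul_eq_iff.2 hk.symm)
    (fun h => hkx (inv_smul_eq_iff.1 h).symm) (.inr ()) (.inl g)
  refine ⟨u * k * v⁻¹, fun g hg hmem => ?_, fun g hg g' hg' h hh h' hh' heq => ?_,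
    fun g hg g' hg' h hh h' hh' heq => ?_⟩
  · refine hB.notMem_of_mapsTo_halfTree hΓ (hout ⟨g, hg⟩) ?_
    simpa [c, mul_assoc] using a.isSymmBiinvariant_decided.inv_mem _ hmem
  · have hh'g := (hB.eq_of_mapsTo_halfTree hΓ (hout ⟨g, hg⟩) (hout ⟨g', hg'⟩) (inv_mem hh')
      (inv_mem hh) (by simpa [c, mul_assoc] using congrArg (·⁻¹) heq)).2
    rw [inv_eq_iff_eq_inv.1 hh'g]
    simp [c]
  · have hside := (hB.eq_of_mapsTo_halfTree hΓ (hout ⟨g, hg⟩) (hin ⟨g', hg'⟩) hh hh'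
      (by simpa [c, mul_assoc] using heq)).1
    simp at hside

theorem exists_le_extension (hΓ : IsAdmissible Γ T x₀ y₀) (a : Approx Γ T x₀) {U W : Set Γ}
    (hU : U.Finite) (hW : W.Finite) (hUW : ∀ u ∈ U, ∀ w ∈ W, u⁻¹ * w ∉ a.Λ) :
    ∃ b, a ≤ b ∧ ∃ z : Γ, (∀ u ∈ U, z⁻¹ * u ∈ b.P) ∧ ∀ w ∈ W, z⁻¹ * w ∈ b.N := by
  obtain ⟨z, hundecided, hrigid, hasymm⟩ := a.exists_separating hΓ (hU.union hW)
  have hdisjoint {F D : Set Γ} (hF : F ⊆ U ∪ W) (hD : D ⊆ a.decided) :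
      Disjoint D ((z⁻¹ * ·) '' F) := by
    rw [Set.disjoint_right]
    rintro _ ⟨g, hg, rfl⟩ hmem
    exact hundecided g (hF hg) (hD hmem)
  have hUW' : Disjoint (doubleCosets a.Λ ((z⁻¹ * ·) '' U ∪ ((z⁻¹ * ·) '' U)⁻¹))
      ((z⁻¹ * ·) '' W) := by
    rw [Set.disjoint_right]
    rintro _ ⟨w, hw, rfl⟩ ⟨h, hh, s, ⟨u, hu, rfl⟩ | ⟨u, hu, heq⟩, h', hh', hmul⟩
    · refine hUW u hu w hw ?_
      rwa [← hrigid u (.inl hu) w (.inr hw) h hh h' hh' hmul, inv_mul_cancel_left]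
    · rw [← inv_inv s, ← heq] at hmul
      exact hasymm u (.inl hu) w (.inr hw) h hh h' hh' hmul
  obtain ⟨b, hab, -, hP, hN⟩ := a.exists_le_subset_P_subset_N (hU.image (z⁻¹ * ·))
    (hW.image (z⁻¹ * ·))
    (hdisjoint Set.subset_union_left (Set.union_subset_union_left _ Set.subset_union_right))
    (hdisjoint Set.subset_union_right (Set.union_subset_union_left _ Set.subset_union_left)) hUW'
  exact ⟨b, hab, z, fun u hu => hP ⟨u, hu, rfl⟩, fun w hw => hN ⟨w, hw, rfl⟩⟩

theorem exists_le_conj_mem (hΓ : IsAdmissible Γ T x₀ y₀) (a : Approx Γ T x₀) {g : Γ}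
    (hg : g ≠ 1) : ∃ b, a ≤ b ∧ ∃ z : Γ, z⁻¹ * g * z ∈ b.P ∪ b.N := by
  obtain ⟨z, hz⟩ : ∃ z : Γ, z⁻¹ * g * z ∉ a.Λ := by
    by_contra! hconj
    obtain ⟨z, -, hrigid, -⟩ := a.exists_separating hΓ (Set.finite_singleton 1)
    have hgΛ : g ∈ a.Λ := by simpa using hconj 1
    exact hg (by simpa using hrigid 1 rfl 1 rfl _ (hconj z) g⁻¹ (inv_mem hgΛ) (by group))
  obtain ⟨b, hab, hΛ, hb | hb⟩ := a.exists_le_mem_decided (z⁻¹ * g * z)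
  · exact ⟨b, hab, z, hb⟩
  · exact absurd (hΛ ▸ hb) hz

end Approx

/-! ### Realization of partial isomorphisms -/

/-- The letters mapping the edge of a branching at `l.swap` to an edge with the same head as the
edge at `l`; up to elements of the stabilizers of their heads, they are `c (inr i)⁻¹ c (inl i)` and
their inverses. -/
def letter {Γ ι : Type*} [Group Γ] (c : ι ⊕ ι → Γ) (u v k : Γ) : ι ⊕ ι → Γ
  | .inl i => (c (.inl i))⁻¹ * (u * k⁻¹ * v⁻¹) * c (.inr i)
  | .inr i => (c (.inr i))⁻¹ * (v * k * u⁻¹) * c (.inl i)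

theorem letter_inv_mul_mul_letter {Γ ι : Type*} [Group Γ] (c : ι ⊕ ι → Γ) (u v k : Γ)
    {l l' : ι ⊕ ι} (hl : l.isLeft = l'.isLeft) :
    (letter c u v k l')⁻¹ * ((c l')⁻¹ * c l) * letter c u v k l = (c l'.swap)⁻¹ * c l.swap := by
  rcases l with i | i <;> rcases l' with j | j
  · simp only [letter, Sum.swap_inl]
    group
  · simp at hl
  · simp at hl
  · simp only [letter, Sum.swap_inr]
    group

theorem IsBranching.isGluing {Γ X ι : Type*} [Group Γ] [MulAction Γ X] {T : SimpleGraph X}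
    {Λ : Subgroup Γ} {C : Set X} {Δ : Set Γ} {x₀ y₀ : X} {c : ι ⊕ ι → Γ} {u v k : Γ}
    (hB : IsBranching T Λ C Δ x₀ y₀ c (Sum.elim (fun _ => u) fun _ => v))
    (hΓ : IsAdmissible Γ T x₀ y₀)
    (hc : ∀ l l', l.isLeft = l'.isLeft → (c l')⁻¹ * c l ∈ Λ → l = l')
    (hk : k • y₀ = y₀) (hkx : k • x₀ ≠ x₀) :
    IsGluing T Λ C Sum.swap (letter c u v k) (fun l => (c l)⁻¹ • x₀)
      fun l => (c l)⁻¹ • (Sum.elim (fun _ => u) (fun _ => v) l : Γ) • y₀ where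
  isCore := hB.isTame.isCore
  bar_ne := by rintro (i | i) <;> simp
  map_bar := by rintro (i | i) <;> simp [letter, mul_assoc]
  mem := hB.mem
  notMem := hB.notMem
  adj := hB.adj hΓ
  smul_eq := by
    have hk' : k⁻¹ • y₀ = y₀ := inv_smul_eq_iff.2 hk.symm
    rintro (i | i) <;> simp [letter, mul_smul, hk, hk']
  smul_ne := by
    rintro (i | i) h
    · have hu : u • x₀ = x₀ := hB.smul_eq (.inl i)
      have hv : v⁻¹ • x₀ = x₀ := inv_smul_eq_iff.2 (hB.smul_eq (.inr i)).symm
      simp only [letter, Sum.swap_inl, mul_smul, smul_inv_smul, hv, smul_left_cancel_iff] at h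
      exact hkx (inv_smul_eq_iff.1 (smul_left_cancel u (h.trans hu.symm))).symm
    · have hu : u⁻¹ • x₀ = x₀ := inv_smul_eq_iff.2 (hB.smul_eq (.inl i)).symm
      have hv : v • x₀ = x₀ := hB.smul_eq (.inr i)
      simp only [letter, Sum.swap_inr, mul_smul, smul_inv_smul, hu, smul_left_cancel_iff] at h
      exact hkx (smul_left_cancel v (h.trans hv.symm))
  free g hg l l' hgl := by
    have hC := hB.isTame.isCore
    have ho : g • (c l)⁻¹ • x₀ = (c l')⁻¹ • x₀ :=
      eq_of_adj_of_adj_of_notMem hΓ.isTree hC.connected (hC.smul_mem g hg _ (hB.mem l)) (hB.mem l')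
        (hB.notMem l') (hgl ▸ hΓ.adj_smul g _ _ (hB.adj hΓ l)) (hB.adj hΓ l')
    obtain ⟨hside, rfl⟩ := hB.rigid g (hB.isTame.le hg) l l' ho hgl
    obtain rfl := hc l l' hside hg
    exact ⟨inv_mul_cancel _, rfl⟩

namespace Approx

variable {Γ X : Type*} [Group Γ] [MulAction Γ X] {T : SimpleGraph X} {x₀ y₀ : X}

theorem exists_le_Λ_eq_gluedSubgroup (a : Approx Γ T x₀) (hA : IsTreeAction Γ T) {C : Set X}
    {L : Type*} [Finite L] {bar : L → L} {θ : L → Γ} {o t : L → X}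
    (hG : IsGluing T a.Λ C bar θ o t) (hΔ : IsTame T a.Λ C a.decided) (hx₀ : x₀ ∈ C)
    (hout : ∀ σ ∈ a.decided, ∀ l, σ • t l ∉ C)
    (hP : ∀ σ ∈ a.P, ∀ l l', σ • o l = o l' → σ • t l = t l' → (θ l')⁻¹ * σ * θ l ∈ a.P)
    (hN : ∀ σ ∈ a.N, ∀ l l', σ • o l = o l' → σ • t l = t l' → (θ l')⁻¹ * σ * θ l ∈ a.N) :
    ∃ b, a ≤ b ∧ b.Λ = gluedSubgroup a.Λ θ := by
  let M := gluedSubgroup a.Λ θ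
  have hM : a.Λ ≤ M := le_gluedSubgroup a.Λ θ
  have hMP := IsSymmBiinvariant.doubleCosets M a.isSymmBiinvariant_P.inv_mem
  have hMN := IsSymmBiinvariant.doubleCosets M a.isSymmBiinvariant_N.inv_mem
  have hP' {σ : Γ} (hσ : σ ∈ a.decided) (h : σ ∈ doubleCosets M a.P) : σ ∈ a.P :=
    hG.mem_of_mem_doubleCosets_gluedSubgroup hA hΔ hout a.isSymmBiinvariant_P
      (fun _ h => Or.inl (Or.inl h)) hP hσ h
  have hN' {σ : Γ} (hσ : σ ∈ a.decided) (h : σ ∈ doubleCosets M a.N) : σ ∈ a.N :=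
    hG.mem_of_mem_doubleCosets_gluedSubgroup hA hΔ hout a.isSymmBiinvariant_N
      (fun _ h => Or.inl (Or.inr h)) hN hσ h
  have hone : (1 : Γ) ∈ a.decided := Or.inr (one_mem a.Λ)
  let b : Approx Γ T x₀ :=
    { Λ := M
      P := doubleCosets M a.P
      N := doubleCosets M a.N
      actsFreely := hG.actsFreely_gluedSubgroup hA a.actsFreely
      exists_isCore := ⟨_, hG.isCore_gluedSubgroup hA, 1, one_mem M, x₀, Or.inl hx₀, one_smul Γ x₀⟩
      isSymmBiinvariant_P := hMP
      isSymmBiinvariant_N := hMN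
      disjoint_Λ_P := hMP.disjoint_coe fun h =>
        Set.disjoint_left.1 a.disjoint_Λ_P (one_mem a.Λ) (hP' hone h)
      disjoint_Λ_N := hMN.disjoint_coe fun h =>
        Set.disjoint_left.1 a.disjoint_Λ_N (one_mem a.Λ) (hN' hone h)
      disjoint_P_N := by
        rw [Set.disjoint_right]
        rintro _ ⟨g, hg, σ, hσ, h, hh, rfl⟩ hmem
        exact Set.disjoint_right.1 a.disjoint_P_N hσ
          (hP' (Or.inl (Or.inr hσ)) ((hMP.mul_mem_iff hg hh).1 hmem))
      exists_finite := by
        obtain ⟨D, hD, hPN⟩ := a.exists_finite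
        exact ⟨D, hD, Set.union_subset
          (doubleCosets_subset_doubleCosets hM (Set.subset_union_left.trans hPN))
          (doubleCosets_subset_doubleCosets hM (Set.subset_union_right.trans hPN))⟩ }
  exact ⟨b, ⟨hM, subset_doubleCosets M a.P, subset_doubleCosets M a.N⟩, rfl⟩

theorem exists_le_realize_of_forall_mem_iff (hΓ : IsAdmissible Γ T x₀ y₀) (a : Approx Γ T x₀)
    {ι : Type*} [Finite ι] (c : ι ⊕ ι → Γ)
    (hΛ : ∀ l l', l.isLeft = l'.isLeft → (c l')⁻¹ * c l ∈ a.Λ → l = l')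
    (hP : ∀ l l', l.isLeft = l'.isLeft → (c l')⁻¹ * c l ∈ a.P → (c l'.swap)⁻¹ * c l.swap ∈ a.P)
    (hN : ∀ l l', l.isLeft = l'.isLeft → (c l')⁻¹ * c l ∈ a.N → (c l'.swap)⁻¹ * c l.swap ∈ a.N) :
    ∃ b, a ≤ b ∧ ∃ g : Γ, ∀ i, (c (.inr i))⁻¹ * g * c (.inl i) ∈ b.Λ := by
  obtain ⟨C, hΔ, hx₀, hcC⟩ := a.exists_isTame hΓ.toIsTreeAction
    (Set.finite_range fun l => (c l)⁻¹ • x₀)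
  obtain ⟨u, v, -, -, hB⟩ := hΓ.exists_isBranching hΔ fun l => hcC ⟨l, rfl⟩
  obtain ⟨k, hk, hkx⟩ := hΓ.exists_smul_ne
  obtain ⟨b, hab, hb⟩ := a.exists_le_Λ_eq_gluedSubgroup hΓ.toIsTreeAction
    (hB.isGluing hΓ hΛ hk hkx) hΔ hx₀ hB.smul_notMem
    (fun σ hσ l l' ho ht => by
      obtain ⟨hside, rfl⟩ := hB.rigid σ (Or.inl (Or.inl hσ)) l l' ho ht
      rw [letter_inv_mul_mul_letter c u v k hside]
      exact hP l l' hside hσ)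
    (fun σ hσ l l' ho ht => by
      obtain ⟨hside, rfl⟩ := hB.rigid σ (Or.inl (Or.inr hσ)) l l' ho ht
      rw [letter_inv_mul_mul_letter c u v k hside]
      exact hN l l' hside hσ)
  exact ⟨b, hab, v * k * u⁻¹, fun i => hb ▸ mem_gluedSubgroup a.Λ (letter c u v k) (.inr i)⟩

theorem exists_le_realize (hΓ : IsAdmissible Γ T x₀ y₀) (a : Approx Γ T x₀) {S : Set (Γ × Γ)}
    (hS : S.Finite) :
    ∃ b, a ≤ b ∧ (∀ p ∈ S, ∀ q ∈ S, p.1⁻¹ * q.1 ∈ b.decided ∧ p.2⁻¹ * q.2 ∈ b.decided) ∧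
      ((∀ p ∈ S, ∀ q ∈ S, p ≠ q → p.1⁻¹ * q.1 ∉ b.Λ ∧ p.2⁻¹ * q.2 ∉ b.Λ) →
        (∀ p ∈ S, ∀ q ∈ S, p.1⁻¹ * q.1 ∈ b.P ↔ p.2⁻¹ * q.2 ∈ b.P) →
        ∃ g : Γ, ∀ p ∈ S, p.2⁻¹ * g * p.1 ∈ b.Λ) := by
  obtain ⟨b, hab, hb⟩ := a.exists_le_subset_decided
    (((hS.prod hS).image fun p => p.1.1⁻¹ * p.2.1).union
      ((hS.prod hS).image fun p => p.1.2⁻¹ * p.2.2))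
  have hdec : ∀ p ∈ S, ∀ q ∈ S, p.1⁻¹ * q.1 ∈ b.decided ∧ p.2⁻¹ * q.2 ∈ b.decided :=
    fun p hp q hq => ⟨hb (.inl ⟨(p, q), ⟨hp, hq⟩, rfl⟩), hb (.inr ⟨(p, q), ⟨hp, hq⟩, rfl⟩)⟩
  by_cases hΛ : ∀ p ∈ S, ∀ q ∈ S, p ≠ q → p.1⁻¹ * q.1 ∉ b.Λ ∧ p.2⁻¹ * q.2 ∉ b.Λ
  swap
  · exact ⟨b, hab, hdec, fun h => absurd h hΛ⟩
  by_cases hP : ∀ p ∈ S, ∀ q ∈ S, p.1⁻¹ * q.1 ∈ b.P ↔ p.2⁻¹ * q.2 ∈ b.P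
  swap
  · exact ⟨b, hab, hdec, fun _ h => absurd h hP⟩
  have hN : ∀ p ∈ S, ∀ q ∈ S, p.1⁻¹ * q.1 ∈ b.N ↔ p.2⁻¹ * q.2 ∈ b.N := by
    intro p hp q hq
    obtain rfl | hpq := eq_or_ne p q
    · simp only [inv_mul_cancel]
    · rw [b.mem_N_iff (hdec p hp q hq).1, b.mem_N_iff (hdec p hp q hq).2, hP p hp q hq]
      simp only [hΛ p hp q hq hpq, not_false_eq_true]
  have := hS.to_subtype
  obtain ⟨d, hbd, g, hg⟩ := b.exists_le_realize_of_forall_mem_iff hΓ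
    (Sum.elim (fun p : S => p.1.1) fun p : S => p.1.2)
    (by
      rintro (p | p) (q | q) hside h
      · exact congrArg _ (Subtype.ext (by_contra fun hne => (hΛ q q.2 p p.2 (Ne.symm hne)).1 h))
      · simp at hside
      · simp at hside
      · exact congrArg _ (Subtype.ext (by_contra fun hne => (hΛ q q.2 p p.2 (Ne.symm hne)).2 h)))
    (by
      rintro (p | p) (q | q) hside h
      exacts [(hP q q.2 p p.2).1 h, by simp at hside, by simp at hside, (hP q q.2 p p.2).2 h])
    (by
      rintro (p | p) (q | q) hside h
      exacts [(hN q q.2 p p.2).1 h, by simp at hside, by simp at hside, (hN q q.2 p p.2).2 h])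
  exact ⟨d, hab.trans hbd, fun p hp q hq => (hdec p hp q hq).imp (decided_mono hbd ·)
    (decided_mono hbd ·), fun _ _ => ⟨g, fun p hp => hg ⟨p, hp⟩⟩⟩

end Approx

/-! ### Random graphs -/

theorem IsRandomGraph.exists_notMem_forall_adj_iff {V : Type*} {R : SimpleGraph V}
    (hR : IsRandomGraph R) {F : Set V} (hF : F.Finite) (p : V → Prop) :
    ∃ z, z ∉ F ∧ ∀ w ∈ F, R.Adj z w ↔ p w := by
  classical
  lift F to Finset V using hF
  obtain ⟨z, hp, hnp, hadj, hnadj⟩ := hR.exists_adj (F.filter p) (F.filter fun w => ¬ p w)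
    (Finset.disjoint_filter_filter_not _ _ _)
  simp only [Finset.mem_filter, not_and, not_not] at hp hnp hadj hnadj
  exact ⟨z, fun hz => hp hz (hnp hz),
    fun w hw => ⟨fun h => by_contra fun hw' => hnadj w ⟨hw, hw'⟩ h, fun h => hadj w ⟨hw, h⟩⟩⟩

/-- The set `f` of pairs is the graph of an isomorphism between induced subgraphs of `R` and
`S`. -/
def IsPartialIso {V W : Type*} (R : SimpleGraph V) (S : SimpleGraph W) (f : Set (V × W)) : Prop :=
  ∀ p ∈ f, ∀ q ∈ f, (p.1 = q.1 ↔ p.2 = q.2) ∧ (R.Adj p.1 q.1 ↔ S.Adj p.2 q.2)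

namespace IsPartialIso

variable {V W : Type*} {R : SimpleGraph V} {S : SimpleGraph W} {f : Set (V × W)}

theorem preimage_swap (hf : IsPartialIso R S f) : IsPartialIso S R (Prod.swap ⁻¹' f) :=
  fun _ hp _ hq => (hf _ hp _ hq).imp Iff.symm Iff.symm

theorem insert (hf : IsPartialIso R S f) {v : V} {w : W} (hv : ∀ p ∈ f, v ≠ p.1)
    (hw : ∀ p ∈ f, w ≠ p.2) (hadj : ∀ p ∈ f, R.Adj v p.1 ↔ S.Adj w p.2) :
    IsPartialIso R S (insert (v, w) f) := by
  rintro _ (rfl | hp) _ (rfl | hq)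
  · simp
  · exact ⟨iff_of_false (hv _ hq) (hw _ hq), hadj _ hq⟩
  · exact ⟨iff_of_false (hv _ hp).symm (hw _ hp).symm, by
      rw [R.adj_comm, S.adj_comm]
      exact hadj _ hp⟩
  · exact hf _ hp _ hq

theorem nonempty_iso (hf : IsPartialIso R S f) (hleft : ∀ v, ∃ w, (v, w) ∈ f)
    (hright : ∀ w, ∃ v, (v, w) ∈ f) : Nonempty (R ≃g S) := by
  choose F hF using hleft
  choose G hG using hright
  exact ⟨{ toFun := F
           invFun := G
           left_inv := fun v => (hf _ (hG (F v)) _ (hF v)).1.2 rfl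
           right_inv := fun w => (hf _ (hF (G w)) _ (hG w)).1.1 rfl
           map_rel_iff' := fun {v v'} => (hf _ (hF v) _ (hF v')).2.symm }⟩

theorem exists_superset_left (hf : IsPartialIso R S f) (hS : IsRandomGraph S) (hfin : f.Finite)
    (v : V) : ∃ f', (f'.Finite ∧ IsPartialIso R S f') ∧ f ⊆ f' ∧ ∃ w, (v, w) ∈ f' := by
  by_cases hv : ∃ w, (v, w) ∈ f
  · exact ⟨f, ⟨hfin, hf⟩, subset_rfl, hv⟩
  obtain ⟨z, hz, hadj⟩ := hS.exists_notMem_forall_adj_iff (hfin.image Prod.snd)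
    fun w => ∃ p ∈ f, p.2 = w ∧ R.Adj v p.1
  refine ⟨Insert.insert (v, z) f, ⟨hfin.insert _, hf.insert ?_ ?_ ?_⟩, Set.subset_insert _ _, z,
    Set.mem_insert _ _⟩
  · rintro p hp rfl
    exact hv ⟨p.2, hp⟩
  · rintro p hp rfl
    exact hz ⟨p, hp, rfl⟩
  · refine fun p hp => Iff.trans ⟨fun h => ⟨p, hp, rfl, h⟩, ?_⟩ (hadj _ ⟨p, hp, rfl⟩).symm
    rintro ⟨q, hq, hqp, h⟩
    rwa [← (hf q hq p hp).1.2 hqp]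

theorem exists_superset_right (hf : IsPartialIso R S f) (hR : IsRandomGraph R) (hfin : f.Finite)
    (w : W) : ∃ f', (f'.Finite ∧ IsPartialIso R S f') ∧ f ⊆ f' ∧ ∃ v, (v, w) ∈ f' := by
  obtain ⟨f', ⟨hfin', hf'⟩, hff', hw⟩ := hf.preimage_swap.exists_superset_left hR
    (hfin.preimage Prod.swap_injective.injOn) w
  exact ⟨Prod.swap ⁻¹' f', ⟨hfin'.preimage Prod.swap_injective.injOn, hf'.preimage_swap⟩,
    fun p hp => hff' (by simpa using hp), hw⟩

end IsPartialIso

theorem IsRandomGraph.nonempty_iso {V W : Type*} {R : SimpleGraph V} {S : SimpleGraph W}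
    (hR : IsRandomGraph R) (hS : IsRandomGraph S) : Nonempty (R ≃g S) := by
  have := hR.countable
  have := hS.countable
  let := Encodable.ofCountable (V ⊕ W)
  let D : V ⊕ W → Order.Cofinal {f : Set (V × W) // f.Finite ∧ IsPartialIso R S f} := Sum.elim
    (fun v => ⟨{f | ∃ w, (v, w) ∈ f.1}, fun f => by
      obtain ⟨f', hf', hff', h⟩ := f.2.2.exists_superset_left hS f.2.1 v
      exact ⟨⟨f', hf'⟩, h, hff'⟩⟩)
    (fun w => ⟨{f | ∃ v, (v, w) ∈ f.1}, fun f => by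
      obtain ⟨f', hf', hff', h⟩ := f.2.2.exists_superset_right hR f.2.1 w
      exact ⟨⟨f', hf'⟩, h, hff'⟩⟩)
  let f₀ : {f : Set (V × W) // f.Finite ∧ IsPartialIso R S f} :=
    ⟨∅, Set.finite_empty, fun _ h => h.elim⟩
  let I := Order.idealOfCofinals f₀ D
  have hI := Order.cofinal_meets_idealOfCofinals f₀ D
  have hunion : IsPartialIso R S {p | ∃ f ∈ I, p ∈ f.1} := by
    rintro p ⟨f, hf, hp⟩ q ⟨f', hf', hq⟩
    obtain ⟨d, -, hfd, hfd'⟩ := I.directed f hf f' hf'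
    exact d.2.2 p (hfd hp) q (hfd' hq)
  refine hunion.nonempty_iso (fun v => ?_) fun w => ?_
  · obtain ⟨f, ⟨w, hw⟩, hf⟩ := hI (.inl v)
    exact ⟨w, f, hf, hw⟩
  · obtain ⟨f, ⟨v, hv⟩, hf⟩ := hI (.inr w)
    exact ⟨v, f, hf, hv⟩

/-! ### Generic coset graphs -/

/-- A symmetric union of double cosets of `Λ` other than `Λ` itself, the set of group elements
labelling the edges of a `Γ`-invariant graph on `Γ ⧸ Λ`. -/
structure IsConnectionSet {Γ : Type*} [Group Γ] (Λ : Subgroup Γ) (P : Set Γ) : Prop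
    extends IsSymmBiinvariant Λ P where
  disjoint : Disjoint (Λ : Set Γ) P

namespace IsConnectionSet

variable {Γ V : Type*} [Group Γ] {Λ : Subgroup Γ} {P : Set Γ} {R : SimpleGraph V}

/-- The graph on `Γ ⧸ Λ` in which `a Λ` and `b Λ` are adjacent if and only if `a⁻¹ b ∈ P`. -/
def cosetGraph (h : IsConnectionSet Λ P) : SimpleGraph (Γ ⧸ Λ) where
  Adj x y := ∃ a b : Γ, (a : Γ ⧸ Λ) = x ∧ (b : Γ ⧸ Λ) = y ∧ a⁻¹ * b ∈ P
  symm := ⟨by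
    rintro x y ⟨a, b, ha, hb, hab⟩
    exact ⟨b, a, hb, ha, by simpa using h.inv_mem _ hab⟩⟩
  loopless := ⟨by
    rintro x ⟨a, b, rfl, hb, hab⟩
    exact Set.disjoint_right.1 h.disjoint hab (QuotientGroup.eq.1 hb.symm)⟩

theorem cosetGraph_adj_mk (h : IsConnectionSet Λ P) (a b : Γ) :
    h.cosetGraph.Adj (a : Γ ⧸ Λ) (b : Γ ⧸ Λ) ↔ a⁻¹ * b ∈ P := by
  refine ⟨?_, fun hab => ⟨a, b, rfl, rfl, hab⟩⟩
  rintro ⟨a', b', ha, hb, hab⟩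
  simpa [mul_assoc] using
    h.mul_mem _ hab _ (QuotientGroup.eq.1 ha.symm) _ (QuotientGroup.eq.1 hb)

theorem cosetGraph_adj (h : IsConnectionSet Λ P) (x y : Γ ⧸ Λ) :
    h.cosetGraph.Adj x y ↔ x.out⁻¹ * y.out ∈ P := by
  rw [← h.cosetGraph_adj_mk, QuotientGroup.out_eq', QuotientGroup.out_eq']

theorem cosetGraph_adj_smul (h : IsConnectionSet Λ P) (g : Γ) (x y : Γ ⧸ Λ) :
    h.cosetGraph.Adj (g • x) (g • y) ↔ h.cosetGraph.Adj x y := by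
  induction x using QuotientGroup.induction_on with | H a
  induction y using QuotientGroup.induction_on with | H b
  change h.cosetGraph.Adj ((g * a : Γ) : Γ ⧸ Λ) ((g * b : Γ) : Γ ⧸ Λ) ↔ _
  rw [cosetGraph_adj_mk, cosetGraph_adj_mk, mul_inv_rev, mul_assoc, inv_mul_cancel_left]

/-- The action of `Γ` on `Γ ⧸ Λ`, transported to a graph `R` isomorphic to the coset graph. -/
def action (h : IsConnectionSet Λ P) (ψ : h.cosetGraph ≃g R) : Γ →* (R ≃g R) where
  toFun g := ψ.symm.trans (RelIso.trans
    { toEquiv := MulAction.toPerm g, map_rel_iff' := h.cosetGraph_adj_smul g _ _ } ψ)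
  map_one' := by
    ext x
    simp [MulAction.toPerm]
  map_mul' g g' := by
    ext x
    simp [MulAction.toPerm, mul_smul]

theorem action_apply (h : IsConnectionSet Λ P) (ψ : h.cosetGraph ≃g R) (g : Γ) (v : V) :
    h.action ψ g v = ψ (g • ψ.symm v) := rfl

end IsConnectionSet

/-- A subgroup `Λ` and a connection set `P` whose coset graph is a random graph on which `Γ` acts
faithfully and homogeneously, expressed in terms of elements of `Γ`. -/
structure IsGeneric {Γ : Type*} [Group Γ] (Λ : Subgroup Γ) (P : Set Γ) : Prop
    extends IsConnectionSet Λ P where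
  exists_extension : ∀ U W : Finset Γ, (∀ u ∈ U, ∀ w ∈ W, u⁻¹ * w ∉ Λ) →
    ∃ z : Γ, (∀ u ∈ U, z⁻¹ * u ∈ P) ∧ ∀ w ∈ W, z⁻¹ * w ∉ P ∧ z⁻¹ * w ∉ Λ
  exists_realize : ∀ S : Finset (Γ × Γ),
    (∀ p ∈ S, ∀ q ∈ S, p ≠ q → p.1⁻¹ * q.1 ∉ Λ ∧ p.2⁻¹ * q.2 ∉ Λ) →
    (∀ p ∈ S, ∀ q ∈ S, p.1⁻¹ * q.1 ∈ P ↔ p.2⁻¹ * q.2 ∈ P) →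
    ∃ g : Γ, ∀ p ∈ S, p.2⁻¹ * g * p.1 ∈ Λ
  exists_conj_notMem : ∀ g : Γ, g ≠ 1 → ∃ z : Γ, z⁻¹ * g * z ∉ Λ

namespace IsGeneric

variable {Γ V : Type*} [Group Γ] {Λ : Subgroup Γ} {P : Set Γ} {R : SimpleGraph V}

theorem isRandomGraph_cosetGraph [Countable Γ] (h : IsGeneric Λ P) :
    IsRandomGraph h.cosetGraph := by
  classical
  refine ⟨QuotientGroup.mk_surjective.countable, fun U W hUW => ?_⟩
  have hout (x y : Γ ⧸ Λ) (hxy : x.out⁻¹ * y.out ∈ Λ) : x = y := by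
    rwa [← QuotientGroup.eq, QuotientGroup.out_eq', QuotientGroup.out_eq'] at hxy
  obtain ⟨z, hU, hW⟩ := h.exists_extension (U.image Quotient.out) (W.image Quotient.out) (by
    simp only [Finset.forall_mem_image]
    exact fun x hx y hy hxy => Finset.disjoint_left.1 hUW hx (hout x y hxy ▸ hy))
  simp only [Finset.forall_mem_image] at hU hW
  have hadj (x : Γ ⧸ Λ) : h.cosetGraph.Adj (z : Γ ⧸ Λ) x ↔ z⁻¹ * x.out ∈ P := by
    rw [← h.cosetGraph_adj_mk, QuotientGroup.out_eq']
  refine ⟨(z : Γ ⧸ Λ), fun hz => ((hadj _).2 (hU hz)).ne rfl, fun hz => (hW hz).2 ?_,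
    fun u hu => (hadj u).2 (hU hu), fun w hw hzw => (hW hw).1 ((hadj w).1 hzw)⟩
  rw [← QuotientGroup.eq, QuotientGroup.out_eq']

theorem action_injective (h : IsGeneric Λ P) (ψ : h.cosetGraph ≃g R) :
    Function.Injective (h.action ψ) := by
  rw [injective_iff_map_eq_one]
  intro g hg
  by_contra hne
  obtain ⟨z, hz⟩ := h.exists_conj_notMem g hne
  have hfix : h.action ψ g (ψ (z : Γ ⧸ Λ)) = ψ (z : Γ ⧸ Λ) := by
    rw [hg]
    rfl
  rw [h.action_apply, ψ.symm_apply_apply] at hfix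
  have hmk : ((z : Γ) : Γ ⧸ Λ) = ((g * z : Γ) : Γ ⧸ Λ) := (ψ.injective hfix).symm
  rw [QuotientGroup.eq, ← mul_assoc] at hmk
  exact hz hmk

theorem isHomogeneousAction (h : IsGeneric Λ P) (ψ : h.cosetGraph ≃g R) :
    IsHomogeneousAction (h.action ψ) := by
  classical
  intro A B hA _ φ
  have := hA.fintype
  let s (v : V) : Γ := (ψ.symm v).out
  have hs (v : V) : (s v : Γ ⧸ Λ) = ψ.symm v := QuotientGroup.out_eq' _
  have hsΛ (v w : V) : (s v)⁻¹ * s w ∈ Λ ↔ v = w := by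
    rw [← QuotientGroup.eq, hs, hs, ψ.symm.injective.eq_iff]
  have hsP (v w : V) : (s v)⁻¹ * s w ∈ P ↔ R.Adj v w := by
    rw [← h.cosetGraph_adj, ψ.symm.map_adj_iff]
  obtain ⟨g, hg⟩ := h.exists_realize (Finset.univ.image fun v : A => (s v, s (φ v)))
    (by
      simp only [Finset.forall_mem_image, hsΛ, Subtype.coe_inj, φ.injective.eq_iff]
      exact fun v _ w _ hne => ⟨fun h => hne (by rw [h]), fun h => hne (by rw [h])⟩)
    (by
      simp only [Finset.forall_mem_image, hsP]
      exact fun v _ w _ => (φ.map_adj_iff (v := v) (w := w)).symm)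
  refine ⟨g, fun v => ?_⟩
  have hgv := hg _ (Finset.mem_image_of_mem _ (Finset.mem_univ v))
  dsimp only at hgv
  rw [mul_assoc, ← QuotientGroup.eq, hs] at hgv
  rw [h.action_apply, ← hs]
  exact (ψ.symm_apply_eq.1 hgv).symm

end IsGeneric

/-! ### Generic limits of approximations -/

namespace Approx

variable {Γ X : Type*} [Group Γ] [MulAction Γ X] {T : SimpleGraph X} {x₀ y₀ : X}

/-- The union of the subgroups of a directed family of approximations. -/
def limitSubgroup (I : Order.Ideal (Approx Γ T x₀)) : Subgroup Γ where
  carrier := {g | ∃ a ∈ I, g ∈ a.Λ}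
  one_mem' := I.nonempty.imp fun a ha => ⟨ha, one_mem a.Λ⟩
  mul_mem' := by
    rintro g h ⟨a, ha, hg⟩ ⟨b, hb, hh⟩
    obtain ⟨d, hd, had, hbd⟩ := I.directed a ha b hb
    exact ⟨d, hd, mul_mem (had.1 hg) (hbd.1 hh)⟩
  inv_mem' := fun ⟨a, ha, hg⟩ => ⟨a, ha, inv_mem hg⟩

/-- The union of the sets of edges of a directed family of approximations. -/
def limitEdges (I : Order.Ideal (Approx Γ T x₀)) : Set Γ := {σ | ∃ a ∈ I, σ ∈ a.P}

variable {I : Order.Ideal (Approx Γ T x₀)} {a : Approx Γ T x₀} {σ : Γ}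

theorem notMem_limitSubgroup (ha : a ∈ I) (hσ : σ ∈ a.P ∪ a.N) : σ ∉ limitSubgroup I := by
  rintro ⟨b, hb, hσb⟩
  obtain ⟨d, -, had, hbd⟩ := I.directed a ha b hb
  exact hσ.elim (fun hσ => Set.disjoint_left.1 d.disjoint_Λ_P (hbd.1 hσb) (had.2.1 hσ))
    fun hσ => Set.disjoint_left.1 d.disjoint_Λ_N (hbd.1 hσb) (had.2.2 hσ)

theorem notMem_limitEdges (ha : a ∈ I) (hσ : σ ∈ a.N) : σ ∉ limitEdges I := by
  rintro ⟨b, hb, hσb⟩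
  obtain ⟨d, -, had, hbd⟩ := I.directed a ha b hb
  exact Set.disjoint_left.1 d.disjoint_P_N (hbd.2.1 hσb) (had.2.2 hσ)

theorem mem_limitEdges_iff (ha : a ∈ I) (hσ : σ ∈ a.decided) : σ ∈ limitEdges I ↔ σ ∈ a.P := by
  refine ⟨fun h => ?_, fun h => ⟨a, ha, h⟩⟩
  rcases hσ with (hσ | hσ) | hσ
  · exact hσ
  · exact absurd h (notMem_limitEdges ha hσ)
  · obtain ⟨b, hb, hσb⟩ := h
    exact absurd ⟨a, ha, hσ⟩ (notMem_limitSubgroup hb (.inl hσb))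

theorem isConnectionSet_limitEdges (I : Order.Ideal (Approx Γ T x₀)) :
    IsConnectionSet (limitSubgroup I) (limitEdges I) where
  mul_mem := by
    rintro σ ⟨a, ha, hσ⟩ g ⟨b, hb, hg⟩ h ⟨b', hb', hh⟩
    obtain ⟨d, hd, had, hbd⟩ := I.directed a ha b hb
    obtain ⟨d', hd', hdd', hbd'⟩ := I.directed d hd b' hb'
    exact ⟨d', hd', d'.isSymmBiinvariant_P.mul_mem σ (hdd'.2.1 (had.2.1 hσ)) g
      (hdd'.1 (hbd.1 hg)) h (hbd'.1 hh)⟩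
  inv_mem := fun σ ⟨a, ha, hσ⟩ => ⟨a, ha, a.isSymmBiinvariant_P.inv_mem σ hσ⟩
  disjoint := Set.disjoint_right.2 fun _ ⟨_, ha, hσ⟩ => notMem_limitSubgroup ha (.inl hσ)

/-- The approximations deciding the instance `U`, `W` of the extension property. -/
def extending (T : SimpleGraph X) (x₀ : X) (U W : Finset Γ) : Set (Approx Γ T x₀) :=
  {b | (∀ u ∈ U, ∀ w ∈ W, u⁻¹ * w ∉ b.Λ) →
    ∃ z : Γ, (∀ u ∈ U, z⁻¹ * u ∈ b.P) ∧ ∀ w ∈ W, z⁻¹ * w ∈ b.N}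

/-- The approximations deciding whether `S` represents a partial isomorphism of the coset graph
and, if so, realizing it by an element of `Γ`. -/
def realizing (T : SimpleGraph X) (x₀ : X) (S : Finset (Γ × Γ)) : Set (Approx Γ T x₀) :=
  {b | (∀ p ∈ S, ∀ q ∈ S, p.1⁻¹ * q.1 ∈ b.decided ∧ p.2⁻¹ * q.2 ∈ b.decided) ∧
    ((∀ p ∈ S, ∀ q ∈ S, p ≠ q → p.1⁻¹ * q.1 ∉ b.Λ ∧ p.2⁻¹ * q.2 ∉ b.Λ) →
      (∀ p ∈ S, ∀ q ∈ S, p.1⁻¹ * q.1 ∈ b.P ↔ p.2⁻¹ * q.2 ∈ b.P) →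
      ∃ g : Γ, ∀ p ∈ S, p.2⁻¹ * g * p.1 ∈ b.Λ)}

/-- The approximations which force `g` to move a coset. -/
def moving (T : SimpleGraph X) (x₀ : X) (g : Γ) : Set (Approx Γ T x₀) :=
  {b | ∃ z : Γ, z⁻¹ * g * z ∈ b.P ∪ b.N}

theorem isCofinal_extending (hΓ : IsAdmissible Γ T x₀ y₀) (U W : Finset Γ) :
    IsCofinal (extending T x₀ U W) := by
  intro a
  by_cases h : ∀ u ∈ U, ∀ w ∈ W, u⁻¹ * w ∉ a.Λ
  · obtain ⟨b, hab, hb⟩ := a.exists_le_extension hΓ U.finite_toSet W.finite_toSet h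
    exact ⟨b, fun _ => hb, hab⟩
  · exact ⟨a, fun h' => absurd h' h, le_rfl⟩

theorem isCofinal_realizing (hΓ : IsAdmissible Γ T x₀ y₀) (S : Finset (Γ × Γ)) :
    IsCofinal (realizing T x₀ S) := by
  intro a
  obtain ⟨b, hab, hb⟩ := a.exists_le_realize hΓ S.finite_toSet
  exact ⟨b, hb, hab⟩

theorem isCofinal_moving (hΓ : IsAdmissible Γ T x₀ y₀) {g : Γ} (hg : g ≠ 1) :
    IsCofinal (moving T x₀ g) := by
  intro a
  obtain ⟨b, hab, hb⟩ := a.exists_le_conj_mem hΓ hg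
  exact ⟨b, hb, hab⟩

theorem isGeneric_limit (I : Order.Ideal (Approx Γ T x₀))
    (hext : ∀ U W, ∃ b ∈ extending T x₀ U W, b ∈ I) (hreal : ∀ S, ∃ b ∈ realizing T x₀ S, b ∈ I)
    (hmov : ∀ g ≠ (1 : Γ), ∃ b ∈ moving T x₀ g, b ∈ I) :
    IsGeneric (limitSubgroup I) (limitEdges I) where
  toIsConnectionSet := isConnectionSet_limitEdges I
  exists_extension U W hUW := by
    obtain ⟨b, hb, hbI⟩ := hext U W
    obtain ⟨z, hzU, hzW⟩ := hb fun u hu w hw h => hUW u hu w hw ⟨b, hbI, h⟩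
    exact ⟨z, fun u hu => ⟨b, hbI, hzU u hu⟩, fun w hw =>
      ⟨notMem_limitEdges hbI (hzW w hw), notMem_limitSubgroup hbI (.inr (hzW w hw))⟩⟩
  exists_realize S hSΛ hSP := by
    obtain ⟨b, ⟨hdecided, hb⟩, hbI⟩ := hreal S
    obtain ⟨g, hg⟩ := hb
      (fun p hp q hq hne => (hSΛ p hp q hq hne).imp (fun hΛ h => hΛ ⟨b, hbI, h⟩)
        fun hΛ h => hΛ ⟨b, hbI, h⟩)
      fun p hp q hq => by
        rw [← mem_limitEdges_iff hbI (hdecided p hp q hq).1,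
          ← mem_limitEdges_iff hbI (hdecided p hp q hq).2, hSP p hp q hq]
    exact ⟨g, fun p hp => ⟨b, hbI, hg p hp⟩⟩
  exists_conj_notMem g hg := by
    obtain ⟨b, ⟨z, hz⟩, hbI⟩ := hmov g hg
    exact ⟨z, notMem_limitSubgroup hbI hz⟩

end Approx

theorem IsAdmissible.exists_isGeneric {Γ X : Type*} [Group Γ] [Countable Γ] [MulAction Γ X]
    {T : SimpleGraph X} {x₀ y₀ : X} (hΓ : IsAdmissible Γ T x₀ y₀) :
    ∃ (Λ : Subgroup Γ) (P : Set Γ), IsGeneric Λ P := by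
  let := Encodable.ofCountable ((Finset Γ × Finset Γ) ⊕ Finset (Γ × Γ) ⊕ {g : Γ // g ≠ 1})
  let D : (Finset Γ × Finset Γ) ⊕ Finset (Γ × Γ) ⊕ {g : Γ // g ≠ 1} →
      Order.Cofinal (Approx Γ T x₀) :=
    Sum.elim (fun p => ⟨_, Approx.isCofinal_extending hΓ p.1 p.2⟩)
      (Sum.elim (fun S => ⟨_, Approx.isCofinal_realizing hΓ S⟩)
        fun g => ⟨_, Approx.isCofinal_moving hΓ g.2⟩)
  have hD := Order.cofinal_meets_idealOfCofinals default D
  exact ⟨_, _, Approx.isGeneric_limit (Order.idealOfCofinals default D)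
    (fun U W => hD (.inl (U, W))) (fun S => hD (.inr (.inl S)))
    fun g hg => hD (.inr (.inr ⟨g, hg⟩))⟩

/-! ### Homogeneous actions on the random graph -/

theorem not_stabilizer_le_stabilizer {Γ X : Type*} [Group Γ] [MulAction Γ X] {x y : X}
    [Finite (edgeStabilizer Γ x y)] [Infinite (MulAction.stabilizer Γ y)] :
    ¬ MulAction.stabilizer Γ y ≤ MulAction.stabilizer Γ x := fun hle =>
  Set.infinite_coe_iff.1 ‹Infinite (MulAction.stabilizer Γ y)›
    ((edgeStabilizer Γ x y : Set Γ).toFinite.subset fun _ hk => Subgroup.mem_inf.2 ⟨hle hk, hk⟩)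

theorem mainTheorem5_general {Γ X V : Type*} [Group Γ] [Countable Γ] [MulAction Γ X]
    (T : SimpleGraph X) (hT : T.IsTree)
    (hact : ∀ (g : Γ) (x y : X), T.Adj x y → T.Adj (g • x) (g • y))
    (hedge : ∀ x y : X, T.Adj x y → Finite (edgeStabilizer Γ x y)) {x₀ y₀ : X} (hxy : T.Adj x₀ y₀)
    (hcore : ((edgeStabilizer Γ x₀ y₀).subgroupOf (MulAction.stabilizer Γ x₀)).IsHighlyCoreFree)
    (hstab : ¬ MulAction.stabilizer Γ y₀ ≤ MulAction.stabilizer Γ x₀)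
    (R : SimpleGraph V) (hR : IsRandomGraph R) :
    ∃ π : Γ →* (R ≃g R), Function.Injective π ∧ IsHomogeneousAction π := by
  have hΓ : IsAdmissible Γ T x₀ y₀ :=
    ⟨⟨hT, hact⟩, hedge, hxy, hcore, by simpa [SetLike.not_le_iff_exists] using hstab⟩
  obtain ⟨Λ, P, h⟩ := hΓ.exists_isGeneric
  obtain ⟨ψ⟩ := h.isRandomGraph_cosetGraph.nonempty_iso hR
  exact ⟨h.action ψ, h.action_injective ψ, h.isHomogeneousAction ψ⟩

theorem mainTheorem5 {Γ X V : Type*} [Group Γ] [Countable Γ] [MulAction Γ X] [Nontrivial X]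
    (T : SimpleGraph X) (hT : T.IsTree)
    (hact : ∀ (g : Γ) (x y : X), T.Adj x y → T.Adj (g • x) (g • y))
    (hinv : ∀ (g : Γ) (x y : X), T.Adj x y → ¬ (g • x = y ∧ g • y = x))
    (hvert : ∀ x : X, Infinite (MulAction.stabilizer Γ x))
    (hedge : ∀ x y : X, T.Adj x y →
      Finite (edgeStabilizer Γ x y) ∧
      ((edgeStabilizer Γ x y).subgroupOf (MulAction.stabilizer Γ x)).IsHighlyCoreFree ∧
      ((edgeStabilizer Γ x y).subgroupOf (MulAction.stabilizer Γ y)).IsHighlyCoreFree)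
    (R : SimpleGraph V) (hR : IsRandomGraph R) :
    ∃ π : Γ →* (R ≃g R), Function.Injective π ∧ IsHomogeneousAction π := by
  obtain ⟨x₀⟩ := hT.connected.nonempty
  obtain ⟨y₀, hxy⟩ := hT.connected.preconnected.exists_adj_of_nontrivial x₀
  have := (hedge x₀ y₀ hxy).1
  exact mainTheorem5_general T hT hact (fun x y h => (hedge x y h).1) hxy (hedge x₀ y₀ hxy).2.1
    not_stabilizer_le_stabilizer R hR
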